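/- **Setting.** Let $\mathbb X\subset\mathbb R^n$ be Lebesgue measurable and let $(X_t)$ be a time-homogeneous continuous-time Markov process on $\mathbb X$ whose transition probability functions have Lebesgue densities: $P^t(x,B)=\int_B p^t(x,y)\,dy$ for $t>0$, with $p^t\ge 0$ jointly measurable. Suppose the process has a unique stationary probability measure $\mu$, that $\mu$ has a continuous, strictly positive Lebesgue density $\pi$, and that $p^t(x,y)\pi(x)=p^t(y,x)\pi(y)$ for all $x,y\in\mathbb X$, $t>0$. Let $\lambda$ be Lebesgue measure on $\mathbb X$ and $\|\cdot\|_{\mathbb K}$ the norm of $\mathbb K=L^1_{\mu\times\lambda}(\mathbb X^2)$. Fix a lag time $\tau>0$, write $p=p^\tau$, and let $r\le n$. Let $\mathbb Z\subset\mathbb R^r$ be a Borel set (e.g. a domain), $|\mathbb Z|$ its Lebesgue measure, and $\xi:\mathbb X\to\mathbb Z$ a reaction coordinate that is $C^1$ on a neighbourhood of $\mathbb X$ with $\det(\nabla\xi^\intercal\nabla\xi)\neq0$ almost everywhere on $\mathbb X$. On the level set $\Sigma_\xi(z)=\{x\in\mathbb X:\xi(x)=z\}$ let $\mu_z$ be the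 marginal stationary measure $$d\mu_z=\pi\,\det(\nabla\xi^\intercal\nabla\xi)^{-1/2}\,dH_{n-r},$$ where $H_{n-r}$ is the $(n-r)$-dimensional Hausdorff measure (the density being read as $0$ at critical points). For $\varepsilon\ge0$ the system is *$\varepsilon$-deflatable* with respect to $\xi$ if there are functions $p_D^t:\mathbb X\times\mathbb Z\to[0,\infty)$ such that, for all $t\ge\tau$, the function $p^t(x,y)-p_D^t(x,\xi(y))\pi(y)$ lies in $\mathbb K$ and $$\frac1{|\mathbb Z|}\big\|p^t(\ast,\cdot)-p_D^t(\ast,\xi(\cdot))\pi(\cdot)\big\|_{\mathbb K}\le\varepsilon .\tag{D}$$ It is *differentially $\varepsilon$-deflatable* with respect to $\xi$ if $$\frac1{|\mathbb Z|}\int_{\mathbb Z}\int_{\Sigma_\xi(z)}\int_{\Sigma_\xi(z)}\Big\|\frac{p(\cdot,y^{(1)})}{\pi(y^{(1)})}-\frac{p(\cdot,y^{(2)})}{\pi(y^{(2)})}\Big\|_{L^1_\mu}d\mu_z(y^{(1)})\,d\mu_z(y^{(2)})\,dz\le\varepsilon .\tag{D'}$$ **Lemma.** Suppose that for almost every $z\in\mathbb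 Z$ the measure $\mu_z$ is a probability measure. If the system is $\varepsilon$-deflatable with respect to $\xi$, then it is differentially $2\varepsilon$-deflatable with respect to $\xi$. Conversely, if the system is differentially $\varepsilon$-deflatable with respect to $\xi$, then it is $\varepsilon$-deflatable with respect to $\xi$; more precisely, (D) holds for all $t\ge\tau$ with $$p_D^t(\cdot,z)=\int_{\Sigma_\xi(z)}\frac{p^t(\cdot,y')}{\pi(y')}\,d\mu_z(y').$$ If the $\mu_z$ are not assumed to be probability measures, both implications remain true when the inner integral over $y^{(1)}$ in (D') and the integral defining $p_D^t$ are replaced by averages, i.e. divided by $\mu_z(\Sigma_\xi(z))$. -/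

import Mathlib

open MeasureTheory ProbabilityTheory
open scoped ENNReal NNReal Matrix

noncomputable section

namespace ReactionCoordinate

/-- Lebesgue measure on a subset `X` of `ℝⁿ`. -/
def lebesgueOn {n : ℕ} (X : Set (EuclideanSpace ℝ (Fin n))) : Measure X :=
  (volume : Measure (EuclideanSpace ℝ (Fin n))).comap Subtype.val

/-- The measure on `X` with Lebesgue density `ρ`. -/
def densityMeasure {n : ℕ} {X : Set (EuclideanSpace ℝ (Fin n))} (ρ : X → ℝ) : Measure X :=
  (lebesgueOn X).withDensity fun x => ENNReal.ofReal (ρ x)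

/-- The law of a time-homogeneous continuous-time Markov process on `X ⊆ ℝⁿ`, given by its
transition probability functions `P t x B = Prob[X_{s+t} ∈ B | X_s = x]`, `t > 0`, which have
Lebesgue densities `p t x`; it has a unique stationary probability measure, whose Lebesgue density
`π` is continuous and strictly positive, and it is reversible. -/
structure MarkovSystem {n : ℕ} (X : Set (EuclideanSpace ℝ (Fin n))) where
  /-- transition probability functions -/
  P : ℝ → Kernel X X
  /-- transition densities -/
  p : ℝ → X → X → ℝ
  /-- stationary density -/
  π : X → ℝ
  isMarkovKernel_P : ∀ t, 0 < t → IsMarkovKernel (P t)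
  /-- Chapman-Kolmogorov equation (Markov property) -/
  chapman_kolmogorov : ∀ s t, 0 < s → 0 < t → P (s + t) = P t ∘ₖ P s
  p_nonneg : ∀ t, 0 < t → ∀ x y, 0 ≤ p t x y
  measurable_p : ∀ t, 0 < t → Measurable (Function.uncurry (p t))
  /-- `P t x` has Lebesgue density `p t x` -/
  P_eq_density : ∀ t, 0 < t → ∀ x, P t x = densityMeasure (p t x)
  continuous_π : Continuous π
  π_pos : ∀ x, 0 < π x
  isProbabilityMeasure_π : IsProbabilityMeasure (densityMeasure π)
  stationary : ∀ t, 0 < t → (P t).Invariant (densityMeasure π)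
  /-- the stationary measure is unique -/
  stationary_unique : ∀ ν : Measure X, IsProbabilityMeasure ν →
    (∀ t, 0 < t → (P t).Invariant ν) → ν = densityMeasure π
  detailed_balance : ∀ t, 0 < t → ∀ x y, p t x y * π x = p t y x * π y

/-- The `r × r` Gram matrix `∇ξ(x)ᵀ ∇ξ(x)`, where the columns of `∇ξ(x)` are the gradients of the
components of `ξ`. -/
def gramMatrix {n r : ℕ} (ξ : EuclideanSpace ℝ (Fin n) → EuclideanSpace ℝ (Fin r))
    (x : EuclideanSpace ℝ (Fin n)) : Matrix (Fin r) (Fin r) ℝ :=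
  let grad : Matrix (Fin n) (Fin r) ℝ :=
    Matrix.of fun i j => fderiv ℝ ξ x (EuclideanSpace.single i 1) j
  gradᵀ * grad

/-- The `z`-level set of `ξ` in `X`. -/
def levelSet {n r : ℕ} (X : Set (EuclideanSpace ℝ (Fin n)))
    (ξ : EuclideanSpace ℝ (Fin n) → EuclideanSpace ℝ (Fin r)) (z : EuclideanSpace ℝ (Fin r)) :
    Set X :=
  {x : X | ξ x = z}

variable {n r : ℕ} {X : Set (EuclideanSpace ℝ (Fin n))}

namespace MarkovSystem

/-- The stationary measure `μ`. -/
def μ (S : MarkovSystem X) : Measure X := densityMeasure S.π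

/-- The marginal stationary measure `μ_z`: it lives on the `z`-level set of `ξ` and has density
`π det(∇ξᵀ∇ξ)^(-1/2)` with respect to the `(n-r)`-dimensional Hausdorff measure (normalized to agree
with Lebesgue measure on `ℝ^(n-r)`). At critical points of `ξ` this density is read as `0`. -/
def marginal (S : MarkovSystem X) (ξ : EuclideanSpace ℝ (Fin n) → EuclideanSpace ℝ (Fin r))
    (z : EuclideanSpace ℝ (Fin r)) : Measure X :=
  ((μHE[n - r] : Measure X).restrict (levelSet X ξ z)).withDensity fun x =>
    ENNReal.ofReal (S.π x * (gramMatrix ξ x).det ^ (-(1 / 2) : ℝ))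

/-- `‖p^t(·,y₁)/π(y₁) - p^t(·,y₂)/π(y₂)‖` in `L¹_μ`. -/
def observableDist (S : MarkovSystem X) (t : ℝ) (y₁ y₂ : X) : ℝ≥0∞ :=
  eLpNorm (fun x => S.p t x y₁ / S.π y₁ - S.p t x y₂ / S.π y₂) 1 S.μ

/-- `ε`-deflatability with lag time `τ` with respect to `ξ : X → Z`, by means of the given family
`pD`: for all `t ≥ τ` the function `p^t(x,y) - p_D^t(x,ξ(y)) π(y)` belongs to
`𝕂 = L¹(μ × λ)` and its norm is at most `ε |Z|`. -/
def IsDeflatableWith (S : MarkovSystem X) (τ : ℝ)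
    (ξ : EuclideanSpace ℝ (Fin n) → EuclideanSpace ℝ (Fin r)) (Z : Set (EuclideanSpace ℝ (Fin r)))
    (pD : ℝ → X → EuclideanSpace ℝ (Fin r) → ℝ) (ε : ℝ≥0) : Prop :=
  ∀ t, τ ≤ t → (∀ x, ∀ z ∈ Z, 0 ≤ pD t x z) ∧
    MemLp (fun q : X × X => S.p t q.1 q.2 - pD t q.1 (ξ q.2) * S.π q.2) 1
      (S.μ.prod (lebesgueOn X)) ∧
    (volume Z)⁻¹ * eLpNorm (fun q : X × X => S.p t q.1 q.2 - pD t q.1 (ξ q.2) * S.π q.2) 1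
      (S.μ.prod (lebesgueOn X)) ≤ ε

/-- `ε`-deflatability with lag time `τ` with respect to `ξ : X → Z`. -/
def IsDeflatable (S : MarkovSystem X) (τ : ℝ)
    (ξ : EuclideanSpace ℝ (Fin n) → EuclideanSpace ℝ (Fin r)) (Z : Set (EuclideanSpace ℝ (Fin r)))
    (ε : ℝ≥0) : Prop :=
  ∃ pD : ℝ → X → EuclideanSpace ℝ (Fin r) → ℝ, S.IsDeflatableWith τ ξ Z pD ε

/-- Differential `ε`-deflatability at lag time `τ` with respect to `ξ : X → Z`. -/
def IsDiffDeflatable (S : MarkovSystem X) (τ : ℝ)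
    (ξ : EuclideanSpace ℝ (Fin n) → EuclideanSpace ℝ (Fin r)) (Z : Set (EuclideanSpace ℝ (Fin r)))
    (ε : ℝ≥0) : Prop :=
  (volume Z)⁻¹ * ∫⁻ z in Z, ∫⁻ y₂, ∫⁻ y₁, S.observableDist τ y₁ y₂
    ∂(S.marginal ξ z) ∂(S.marginal ξ z) ≤ ε

/-- Variant of differential `ε`-deflatability for marginal measures that are not normalized: the
inner integral is the average `μ_z(Σ(z))⁻¹ ∫ … dμ_z`. -/
def IsAvgDiffDeflatable (S : MarkovSystem X) (τ : ℝ)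
    (ξ : EuclideanSpace ℝ (Fin n) → EuclideanSpace ℝ (Fin r)) (Z : Set (EuclideanSpace ℝ (Fin r)))
    (ε : ℝ≥0) : Prop :=
  (volume Z)⁻¹ * ∫⁻ z in Z, ∫⁻ y₂, ⨍⁻ y₁, S.observableDist τ y₁ y₂
    ∂(S.marginal ξ z) ∂(S.marginal ξ z) ≤ ε

end MarkovSystem

end ReactionCoordinate

end

/-!
By the coarea formula the marginal measures `μ_z` disintegrate the stationary measure:
`μ = ∫ μ_z dz`, with `μ_z` concentrated on the level set `Σ(z)`. Both notions of deflatability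
therefore concern the function `u(x, y) = p(x, y) / π(y)` in `L¹(μ × μ)`. If `u(x, y)` is within
distance `δ` of a function `p_D(x, ξ(y))`, which is constant on level sets, the triangle inequality
through `p_D` bounds the oscillation of `u` on level sets by `2δ`. Conversely, by Jensen's
inequality, the distance of `u(x, y)` from its average over the level set of `y` is at most this
oscillation.

The bound passes from the lag time `τ` to all `t ≥ τ` because, by reversibility, `u(·, y)` is the
density of `P^t(y, ·)` with respect to `μ`. The `L¹` distance of `u(·, y₁)` and `u(·, y₂)` is thus
the total variation distance of `P^t(y₁, ·)` and `P^t(y₂, ·)`, which Markov kernels contract.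

The coarea formula for `f` holds up to any factor `a > 1`: on a small piece `f` is close to a
surjective linear map `A`, and the injective map `x ↦ (f x, P x)`, with `P` the orthogonal
projection to `ker A`, turns the fibers of `f` into parallel slices while nearly preserving their
Hausdorff measure, so that Fubini's theorem and the change of variables formula apply.
-/

noncomputable section

namespace ReactionCoordinate

section Hausdorff

variable {A B : Type*} [MetricSpace A] [MeasurableSpace A] [BorelSpace A]
  [MetricSpace B] [MeasurableSpace B] [BorelSpace B] {f : A → B} {s : Set A} {K : ℝ≥0}

theorem euclideanHausdorffMeasure_image_le (hf : LipschitzOnWith K f s) (d : ℕ) :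
    μHE[d] (f '' s) ≤ (K : ℝ≥0∞) ^ d * μHE[d] s := by
  have h := hf.hausdorffMeasure_image_le (d := d) (Nat.cast_nonneg d)
  rw [ENNReal.rpow_natCast] at h
  simp only [Measure.euclideanHausdorffMeasure_def, Measure.smul_apply, mul_smul_comm]
  exact smul_le_smul_of_nonneg_left h zero_le

theorem euclideanHausdorffMeasure_le_image
    (hf : ∀ x ∈ s, ∀ y ∈ s, dist x y ≤ K * dist (f x) (f y)) (d : ℕ) :
    μHE[d] s ≤ (K : ℝ≥0∞) ^ d * μHE[d] (f '' s) := by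
  rcases s.eq_empty_or_nonempty with rfl | ⟨x₀, -⟩
  · simp
  have : Nonempty A := ⟨x₀⟩
  have injOn : Set.InjOn f s := fun x hx y hy hxy =>
    dist_le_zero.1 <| (hf x hx y hy).trans_eq <| by rw [hxy, dist_self, mul_zero]
  have lipschitzOn : LipschitzOnWith K (Function.invFunOn f s) (f '' s) := by
    refine LipschitzOnWith.of_dist_le_mul ?_
    rintro _ ⟨x, hx, rfl⟩ _ ⟨y, hy, rfl⟩
    rw [injOn.leftInvOn_invFunOn hx, injOn.leftInvOn_invFunOn hy]
    exact hf x hx y hy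
  simpa only [injOn.invFunOn_image subset_rfl]
    using euclideanHausdorffMeasure_image_le lipschitzOn d

end Hausdorff

theorem measurableSet_inter_preimage_singleton {α β : Type*} [TopologicalSpace α]
    [MeasurableSpace α] [OpensMeasurableSpace α] [TopologicalSpace β] [T1Space β] {f : α → β}
    {s : Set α} (hs : MeasurableSet s) (hf : ContinuousOn f s) (z : β) :
    MeasurableSet (s ∩ f ⁻¹' {z}) := by
  obtain ⟨u, hu, h⟩ := continuousOn_iff_isClosed.1 hf {z} isClosed_singleton
  rw [Set.inter_comm, h]
  exact hu.measurableSet.inter hs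

section Coarea

variable {E F : Type*} [NormedAddCommGroup E] [InnerProductSpace ℝ E] [FiniteDimensional ℝ E]
  [NormedAddCommGroup F] [InnerProductSpace ℝ F] [FiniteDimensional ℝ F]

/-- The coarea factor `√(det (L Lᵀ))` of a linear map `L`, i.e. the Jacobian of `L` restricted to
the orthogonal complement of its kernel. For the derivative of `ξ` this is `det(∇ξᵀ∇ξ)^(1/2)`. -/
def coareaFactor (L : E →L[ℝ] F) : ℝ :=
  √(L.toLinearMap ∘ₗ L.toLinearMap.adjoint).det

theorem det_comp_adjoint_eq_normDet_sq (L : E →L[ℝ] F) :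
    (L.toLinearMap ∘ₗ L.toLinearMap.adjoint).det = L.toLinearMap.adjoint.normDet ^ 2 := by
  simpa using (L.toLinearMap.adjoint.normDet_sq).symm

theorem coareaFactor_eq_normDet (L : E →L[ℝ] F) :
    coareaFactor L = L.toLinearMap.adjoint.normDet := by
  rw [coareaFactor, det_comp_adjoint_eq_normDet_sq, Real.sqrt_sq (LinearMap.normDet_nonneg _)]

theorem coareaFactor_nonneg (L : E →L[ℝ] F) : 0 ≤ coareaFactor L :=
  Real.sqrt_nonneg _

theorem surjective_of_coareaFactor_ne_zero {L : E →L[ℝ] F} (hL : coareaFactor L ≠ 0) :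
    Function.Surjective L := by
  rw [coareaFactor_eq_normDet] at hL
  have adjoint_injective : Function.Injective L.toLinearMap.adjoint :=
    ((LinearMap.normDet_ne_zero_tfae _).out 0 4).1 hL
  have orthogonal_range_eq_bot : L.toLinearMap.rangeᗮ = ⊥ := by
    rw [LinearMap.orthogonal_range]
    exact LinearMap.ker_eq_bot.2 adjoint_injective
  exact LinearMap.range_eq_top.1 ((Submodule.orthogonal_eq_bot_iff).1 orthogonal_range_eq_bot)

theorem continuous_coareaFactor : Continuous (coareaFactor : (E →L[ℝ] F) → ℝ) := by
  have : CompleteSpace E := FiniteDimensional.complete ℝ E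
  have : CompleteSpace F := FiniteDimensional.complete ℝ F
  have h : Continuous fun L : E →L[ℝ] F => L ∘L ContinuousLinearMap.adjoint L :=
    continuous_id.clm_comp (ContinuousLinearMap.adjoint (𝕜 := ℝ)).continuous
  exact (ContinuousLinearMap.continuous_det.comp h).sqrt

theorem det_id_add_comp_comm (u : F →ₗ[ℝ] E) (v : E →ₗ[ℝ] F) :
    (LinearMap.id + u ∘ₗ v).det = (LinearMap.id + v ∘ₗ u).det := by
  let bE := (stdOrthonormalBasis ℝ E).toBasis
  let bF := (stdOrthonormalBasis ℝ F).toBasis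
  rw [← LinearMap.det_toMatrix bE, ← LinearMap.det_toMatrix bF, map_add, map_add,
    LinearMap.toMatrix_id, LinearMap.toMatrix_id, LinearMap.toMatrix_comp bE bF bE,
    LinearMap.toMatrix_comp bF bE bF, Matrix.det_one_add_mul_comm]

/-- The map `x ↦ (f x, P x)`, with `P` the orthogonal projection to the complement of `i(F)`, read
in `E = i(F) ⊕ i(F)ᗮ`. It maps the fibers of `f` to parallel slices. -/
def straighten (i : F →ₗᵢ[ℝ] E) (f : E → F) (x : E) : E :=
  i (f x) + i.rangeᗮ.starProjection x

/-- The derivative of `straighten i f` where `f` has derivative `A`. -/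
def straightenDeriv (i : F →ₗᵢ[ℝ] E) (A : E →L[ℝ] F) : E →L[ℝ] E :=
  i.toContinuousLinearMap ∘L A + i.rangeᗮ.starProjection

theorem adjoint_apply_isometry (i : F →ₗᵢ[ℝ] E) (z : F) : i.toLinearMap.adjoint (i z) = z :=
  ext_inner_right ℝ fun w => by
    rw [LinearMap.adjoint_inner_left]
    exact i.inner_map_map z w

theorem starProjection_range_isometry (i : F →ₗᵢ[ℝ] E) (x : E) :
    i.range.starProjection x = i (i.toLinearMap.adjoint x) := by
  refine Submodule.eq_starProjection_of_mem_orthogonal (LinearMap.mem_range_self _ _) ?_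
  rintro _ ⟨z, rfl⟩
  have : inner ℝ (i z) (i (i.toLinearMap.adjoint x)) = inner ℝ (i z) x := by
    rw [i.inner_map_map, LinearMap.adjoint_inner_right]; rfl
  simp [inner_sub_right, this]

theorem det_straightenDeriv (i : F →ₗᵢ[ℝ] E) (A : E →L[ℝ] F) :
    (straightenDeriv i A).det = (A.toLinearMap ∘ₗ i.toLinearMap).det := by
  have eq_id_add_comp : (straightenDeriv i A).toLinearMap =
      LinearMap.id + i.toLinearMap ∘ₗ (A.toLinearMap - i.toLinearMap.adjoint) := by
    ext x
    simp only [straightenDeriv, ContinuousLinearMap.toLinearMap_add,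
      ContinuousLinearMap.toLinearMap_comp, LinearIsometry.toLinearMap_toContinuousLinearMap,
      LinearMap.add_apply, LinearMap.coe_comp, LinearIsometry.coe_toLinearMap,
      ContinuousLinearMap.coe_coe, Function.comp_apply, Submodule.starProjection_orthogonal_val,
      starProjection_range_isometry, LinearMap.id_coe, id_eq, LinearMap.sub_apply, map_sub]
    abel
  rw [ContinuousLinearMap.det, eq_id_add_comp, det_id_add_comp_comm]
  congr 1
  ext z
  simp [adjoint_apply_isometry]

theorem abs_det_straightenDeriv (i : F →ₗᵢ[ℝ] E) {A : E →L[ℝ] F} (hA : A.ker = i.rangeᗮ) :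
    |(straightenDeriv i A).det| = coareaFactor A := by
  set B := A.toLinearMap ∘ₗ i.toLinearMap with hB
  have factorization : A.toLinearMap = B ∘ₗ i.toLinearMap.adjoint := by
    ext x
    have : x - i.range.starProjection x ∈ A.ker := hA ▸ i.range.sub_starProjection_mem_orthogonal x
    simpa [hB, starProjection_range_isometry, sub_eq_zero] using this
  have comp_adjoint : A.toLinearMap ∘ₗ A.toLinearMap.adjoint = B ∘ₗ B.adjoint := by
    rw [factorization]
    ext z
    simp [LinearMap.adjoint_comp, adjoint_apply_isometry]
  have det_adjoint : B.adjoint.det = B.det := by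
    let b := stdOrthonormalBasis ℝ F
    rw [← LinearMap.det_toMatrix b.toBasis, LinearMap.toMatrix_adjoint,
      Matrix.det_conjTranspose, LinearMap.det_toMatrix, star_trivial]
  rw [coareaFactor, comp_adjoint, LinearMap.det_comp, det_adjoint, Real.sqrt_mul_self_eq_abs,
    det_straightenDeriv]

theorem exists_isometry_orthogonal_range_eq_ker {A : E →L[ℝ] F} (hA : Function.Surjective A) :
    ∃ i : F →ₗᵢ[ℝ] E, A.ker = i.rangeᗮ := by
  have finrank_eq : Module.finrank ℝ F = Module.finrank ℝ A.kerᗮ := by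
    have h1 := A.ker.finrank_add_finrank_orthogonal
    have h2 := A.toLinearMap.finrank_range_add_finrank_ker
    rw [LinearMap.range_eq_top.2 hA, finrank_top] at h2
    omega
  let e : F ≃ₗᵢ[ℝ] A.kerᗮ :=
    (stdOrthonormalBasis ℝ F).equiv (stdOrthonormalBasis ℝ A.kerᗮ) (finCongr finrank_eq)
  refine ⟨A.kerᗮ.subtypeₗᵢ.comp e.toLinearIsometry, ?_⟩
  have range_eq : (A.kerᗮ.subtypeₗᵢ.comp e.toLinearIsometry).range = A.kerᗮ := by
    ext x
    exact ⟨by rintro ⟨z, rfl⟩; exact (e z).2, fun hx => ⟨e.symm ⟨x, hx⟩, by simp⟩⟩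
  rw [range_eq, Submodule.orthogonal_orthogonal]

omit [FiniteDimensional ℝ F] in
theorem exists_norm_sub_starProjection_ker_le (A : E →L[ℝ] F) :
    ∃ N : ℝ≥0, ∀ v, ‖v - A.ker.starProjection v‖ ≤ N * ‖A v‖ := by
  obtain ⟨N, -, hN⟩ := (A.toLinearMap.domRestrict A.kerᗮ).exists_antilipschitzWith <| by
    refine LinearMap.ker_eq_bot'.2 fun v hv => Subtype.ext ?_
    exact A.ker.inf_orthogonal_eq_bot.le ⟨hv, v.2⟩
  refine ⟨N, fun v => ?_⟩
  have hAv : A (A.ker.starProjection v) = 0 := A.ker.starProjection_apply_mem v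
  simpa [hAv] using hN.le_mul_norm (map_zero _) ⟨_, A.ker.sub_starProjection_mem_orthogonal v⟩

omit [FiniteDimensional ℝ F] in
theorem finrank_orthogonal_range (i : F →ₗᵢ[ℝ] E) :
    Module.finrank ℝ i.rangeᗮ = Module.finrank ℝ E - Module.finrank ℝ F := by
  have h1 := i.range.finrank_add_finrank_orthogonal
  have h2 := LinearMap.finrank_range_of_inj i.injective
  omega

theorem isometry_add_coe_inj {i : F →ₗᵢ[ℝ] E} {z z' : F} {w w' : i.rangeᗮ} :
    i z + (w : E) = i z' + (w' : E) ↔ z = z' ∧ w = w' := by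
  refine ⟨fun h => ?_, by rintro ⟨rfl, rfl⟩; rfl⟩
  have adjoint_coe (v : i.rangeᗮ) : i.toLinearMap.adjoint v = 0 := by
    rw [← LinearMap.mem_ker, ← LinearMap.orthogonal_range]
    exact v.2
  obtain rfl : z = z' := by
    simpa [adjoint_apply_isometry, adjoint_coe] using congrArg i.toLinearMap.adjoint h
  exact ⟨rfl, Subtype.ext (add_left_cancel h)⟩

variable {i : F →ₗᵢ[ℝ] E} {f : E → F} {f' : E → E →L[ℝ] F} {A : E →L[ℝ] F} {B : Set E}

omit [FiniteDimensional ℝ E] in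
theorem hasFDerivWithinAt_straighten (i : F →ₗᵢ[ℝ] E) {x : E} {L : E →L[ℝ] F}
    (hf : HasFDerivWithinAt f L B x) :
    HasFDerivWithinAt (straighten i f) (straightenDeriv i L) B x :=
  (i.toContinuousLinearMap.hasFDerivAt.comp_hasFDerivWithinAt x hf).add
    i.rangeᗮ.starProjection.hasFDerivWithinAt

theorem slice_straighten_image (z : F) :
    {w : i.rangeᗮ | i z + (w : E) ∈ straighten i f '' B} =
      i.rangeᗮ.orthogonalProjectionOnto '' (B ∩ f ⁻¹' {z}) := by
  ext w
  constructor
  · rintro ⟨x, hx, hxw⟩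
    obtain ⟨hz, hw⟩ := (isometry_add_coe_inj (w := i.rangeᗮ.orthogonalProjectionOnto x)).1 hxw
    exact ⟨x, ⟨hx, hz⟩, hw⟩
  · rintro ⟨x, ⟨hx, rfl⟩, rfl⟩
    exact ⟨x, hx, rfl⟩

theorem injOn_straighten {b : ℝ≥0} (hB : ∀ x ∈ B, ∀ y ∈ B, f x = f y →
      dist x y ≤ b * dist (i.rangeᗮ.orthogonalProjectionOnto x)
        (i.rangeᗮ.orthogonalProjectionOnto y)) :
    Set.InjOn (straighten i f) B := by
  intro x hx y hy hxy
  obtain ⟨hz, hw⟩ := (isometry_add_coe_inj (w := i.rangeᗮ.orthogonalProjectionOnto x)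
    (w' := i.rangeᗮ.orthogonalProjectionOnto y)).1 hxy
  exact dist_le_zero.1 <| (hB x hx y hy hz).trans_eq <| by rw [hw, dist_self, mul_zero]

omit [FiniteDimensional ℝ F] in
theorem dist_le_mul_dist_orthogonalProjectionOnto {δ N b : ℝ≥0} {K : Submodule ℝ E}
    (hf : ApproximatesLinearOn f A B δ)
    (hK : ∀ v, ‖v - K.starProjection v‖ ≤ N * ‖A v‖) (hb : 1 ≤ b * (1 - N * δ : ℝ))
    {x y : E} (hx : x ∈ B) (hy : y ∈ B) (hxy : f x = f y) :
    dist x y ≤ b * dist (K.orthogonalProjectionOnto x) (K.orthogonalProjectionOnto y) := by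
  have norm_apply_le : ‖A (x - y)‖ ≤ δ * ‖x - y‖ := by
    simpa [hxy, norm_sub_rev (A y)] using hf x hx y hy
  have : ‖x - y‖ ≤ ‖K.starProjection (x - y)‖ + N * (δ * ‖x - y‖) :=
    (norm_le_norm_add_norm_sub' _ _).trans <|
      add_le_add_right ((hK _).trans (mul_le_mul_of_nonneg_left norm_apply_le N.2)) _
  calc dist x y = ‖x - y‖ := dist_eq_norm _ _
    _ ≤ b * (1 - N * δ) * ‖x - y‖ := le_mul_of_one_le_left (norm_nonneg _) hb
    _ = b * (‖x - y‖ - N * (δ * ‖x - y‖)) := by ring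
    _ ≤ b * ‖K.starProjection (x - y)‖ := by gcongr; linarith
    _ = b * dist (K.orthogonalProjectionOnto x) (K.orthogonalProjectionOnto y) := by
      rw [dist_eq_norm, ← map_sub]; rfl

variable [MeasurableSpace E] [BorelSpace E]

theorem euclideanHausdorffMeasure_fiber_le {b : ℝ≥0} (hB : ∀ x ∈ B, ∀ y ∈ B, f x = f y →
      dist x y ≤ b * dist (i.rangeᗮ.orthogonalProjectionOnto x)
        (i.rangeᗮ.orthogonalProjectionOnto y)) (z : F) :
    μHE[Module.finrank ℝ E - Module.finrank ℝ F] (B ∩ f ⁻¹' {z}) ≤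
      b ^ (Module.finrank ℝ E - Module.finrank ℝ F) *
        (volume : Measure i.rangeᗮ) {w | i z + (w : E) ∈ straighten i f '' B} := by
  rw [slice_straighten_image, ← InnerProductSpace.euclideanHausdorffMeasure_eq_volume,
    finrank_orthogonal_range]
  exact euclideanHausdorffMeasure_le_image
    (fun x hx y hy => hB x hx.1 y hy.1 (hx.2.trans hy.2.symm)) _

theorem volume_slice_straighten_le (z : F) :
    (volume : Measure i.rangeᗮ) {w | i z + (w : E) ∈ straighten i f '' B} ≤
      μHE[Module.finrank ℝ E - Module.finrank ℝ F] (B ∩ f ⁻¹' {z}) := by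
  rw [slice_straighten_image, ← InnerProductSpace.euclideanHausdorffMeasure_eq_volume,
    finrank_orthogonal_range]
  simpa using euclideanHausdorffMeasure_image_le
    (i.rangeᗮ.lipschitzWith_orthogonalProjectionOnto.lipschitzOnWith) _

omit [FiniteDimensional ℝ F] in
theorem ae_nnnorm_sub_le_of_approximatesLinearOn (i : F →ₗᵢ[ℝ] E) {δ : ℝ≥0}
    (hf : ApproximatesLinearOn f A B δ)
    (hB : MeasurableSet B) (hf' : ∀ x ∈ B, HasFDerivWithinAt f (f' x) B x) :
    ∀ᵐ x ∂volume.restrict B, ‖f' x - A‖₊ ≤ δ := by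
  have comp_approx : ApproximatesLinearOn (i ∘ f) (i.toContinuousLinearMap ∘L A) B δ :=
    fun x hx y hy => by
      simpa [← map_sub, i.norm_map] using hf x hx y hy
  filter_upwards [comp_approx.norm_fderiv_sub_le volume hB
    (fun x => i.toContinuousLinearMap ∘L f' x)
    (fun x hx => i.toContinuousLinearMap.hasFDerivAt.comp_hasFDerivWithinAt x (hf' x hx))]
    with x hx
  rwa [← ContinuousLinearMap.comp_sub, ← NNReal.coe_le_coe, coe_nnnorm,
    i.norm_toContinuousLinearMap_comp] at hx

variable [MeasurableSpace F] [BorelSpace F]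

omit [FiniteDimensional ℝ F] in
theorem measurable_volume_slice (i : F →ₗᵢ[ℝ] E) {C : Set E} (hC : MeasurableSet C) :
    Measurable fun z => (volume : Measure i.rangeᗮ) {w | i z + (w : E) ∈ C} := by
  have h : Measurable fun q : F × i.rangeᗮ => i q.1 + (q.2 : E) := by fun_prop
  exact measurable_measure_prodMk_left (h hC)

theorem lintegral_volume_slice (i : F →ₗᵢ[ℝ] E) {C : Set E} (hC : MeasurableSet C) :
    ∫⁻ z, (volume : Measure i.rangeᗮ) {w | i z + (w : E) ∈ C} = volume C := by
  have decomposition : MeasurePreserving (i.range.measurableEquivProd (0 : E)).symm := by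
    rw [← InnerProductSpace.euclideanHausdorffMeasure_eq_volume (V := E)]
    exact (i.range.measurePreserving_measurableEquivProd (0 : E)).symm
  have : MeasurePreserving i.equivRange := i.equivRange.measurePreserving
  have preserving : MeasurePreserving (fun q : F × i.rangeᗮ => i q.1 + (q.2 : E))
      (volume.prod volume) := by
    convert decomposition.comp (this.prod (MeasurePreserving.id volume)) using 1
    ext q
    simp
  rw [← preserving.measure_preimage hC.nullMeasurableSet,
    Measure.prod_apply (preserving.measurable hC)]
  rfl

theorem lintegral_volume_slice_straighten (hB : MeasurableSet B)
    (hf : ∀ x ∈ B, HasFDerivWithinAt f (f' x) B x) (hinj : Set.InjOn (straighten i f) B) :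
    ∫⁻ z, (volume : Measure i.rangeᗮ) {w | i z + (w : E) ∈ straighten i f '' B} =
      ∫⁻ x in B, ENNReal.ofReal |(straightenDeriv i (f' x)).det| := by
  have hΦ := fun x hx => hasFDerivWithinAt_straighten i (hf x hx)
  rw [lintegral_volume_slice i (measurable_image_of_fderivWithin hB hΦ hinj),
    lintegral_abs_det_fderiv_eq_addHaar_image volume hB hΦ hinj]

/-- The coarea formula on `B`, up to the factor `a`: `v` is a measurable approximation of the
function `z ↦ H(B ∩ f⁻¹(z))`, and the integrals of `v` and of the coarea factor agree up to `a`. -/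
structure CoareaApprox (f : E → F) (f' : E → E →L[ℝ] F) (B : Set E) (a : ℝ≥0) (v : F → ℝ≥0∞) :
    Prop where
  measurable : Measurable v
  le_fiber : ∀ z, v z ≤ μHE[Module.finrank ℝ E - Module.finrank ℝ F] (B ∩ f ⁻¹' {z})
  fiber_le : ∀ z, μHE[Module.finrank ℝ E - Module.finrank ℝ F] (B ∩ f ⁻¹' {z}) ≤ a * v z
  lintegral_le : ∫⁻ z, v z ≤ a * ∫⁻ x in B, ENNReal.ofReal (coareaFactor (f' x))
  le_lintegral : ∫⁻ x in B, ENNReal.ofReal (coareaFactor (f' x)) ≤ a * ∫⁻ z, v z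

theorem coareaApprox_of_approximatesLinearOn {a b δ N : ℝ≥0} (hB : MeasurableSet B)
    (hf' : ∀ x ∈ B, HasFDerivWithinAt f (f' x) B x) (hf : ApproximatesLinearOn f A B δ)
    (hN : ∀ v, ‖v - i.rangeᗮ.starProjection v‖ ≤ N * ‖A v‖) (hb : 1 ≤ b * (1 - N * δ : ℝ))
    (hba : b ^ (Module.finrank ℝ E - Module.finrank ℝ F) ≤ a)
    (hJ : ∀ L : E →L[ℝ] F, ‖L - A‖₊ ≤ δ →
      |(straightenDeriv i L).det| ≤ a * coareaFactor L ∧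
        coareaFactor L ≤ a * |(straightenDeriv i L).det|) :
    CoareaApprox f f' B a
      fun z => (volume : Measure i.rangeᗮ) {w | i z + (w : E) ∈ straighten i f '' B} := by
  have fiber_dist := fun x hx y hy => dist_le_mul_dist_orthogonalProjectionOnto (x := x) (y := y)
    hf hN hb hx hy
  have injOn : Set.InjOn (straighten i f) B := injOn_straighten fiber_dist
  have ae_near := ae_nnnorm_sub_le_of_approximatesLinearOn i hf hB hf'
  have ofReal_mul_le {s t : ℝ} (h : s ≤ a * t) : ENNReal.ofReal s ≤ a * ENNReal.ofReal t := by
    grw [h]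
    rw [ENNReal.ofReal_mul a.coe_nonneg, ENNReal.ofReal_coe_nnreal]
  refine ⟨measurable_volume_slice i (measurable_image_of_fderivWithin hB
    (fun x hx => hasFDerivWithinAt_straighten i (hf' x hx)) injOn),
    volume_slice_straighten_le, fun z => ?_, ?_, ?_⟩
  · grw [euclideanHausdorffMeasure_fiber_le fiber_dist, ← hba]
    simp
  all_goals
    rw [lintegral_volume_slice_straighten hB hf' injOn,
      ← lintegral_const_mul' _ _ ENNReal.coe_ne_top]
    refine lintegral_mono_ae ?_
    filter_upwards [ae_near] with x hx
  exacts [ofReal_mul_le (hJ _ hx).1, ofReal_mul_le (hJ _ hx).2]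

omit [MeasurableSpace E] [BorelSpace E] [MeasurableSpace F] [BorelSpace F] in
theorem eventually_coareaFactor_comparable {a : ℝ} (ha : 1 < a) (hA : coareaFactor A ≠ 0)
    (hi : A.ker = i.rangeᗮ) :
    ∀ᶠ L in nhds A, |(straightenDeriv i L).det| ≤ a * coareaFactor L ∧
        coareaFactor L ≤ a * |(straightenDeriv i L).det| := by
  have pos : 0 < coareaFactor A := lt_of_le_of_ne (coareaFactor_nonneg A) hA.symm
  have cont_det : Continuous fun L : E →L[ℝ] F => |(straightenDeriv i L).det| := by
    refine (ContinuousLinearMap.continuous_det.comp ?_).abs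
    unfold straightenDeriv
    fun_prop
  have det_lt : |(straightenDeriv i A).det| < a * coareaFactor A := by
    rw [abs_det_straightenDeriv i hi]; exact lt_mul_of_one_lt_left pos ha
  have lt_det : coareaFactor A < a * |(straightenDeriv i A).det| := by
    rw [abs_det_straightenDeriv i hi]; exact lt_mul_of_one_lt_left pos ha
  filter_upwards [cont_det.continuousAt.eventually_lt
    (continuous_coareaFactor.const_mul a).continuousAt det_lt,
    continuous_coareaFactor.continuousAt.eventually_lt
      (cont_det.const_mul a).continuousAt lt_det] with L h₁ h₂
  exact ⟨h₁.le, h₂.le⟩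

theorem exists_coareaApprox_of_approximatesLinearOn {a : ℝ≥0} (ha : 1 < a)
    (hA : coareaFactor A ≠ 0) :
    ∃ δ : ℝ≥0, 0 < δ ∧ ∀ (f : E → F) (f' : E → E →L[ℝ] F) (B : Set E), MeasurableSet B →
      (∀ x ∈ B, HasFDerivWithinAt f (f' x) B x) → ApproximatesLinearOn f A B δ →
        ∃ v, CoareaApprox f f' B a v := by
  obtain ⟨i, hi⟩ := exists_isometry_orthogonal_range_eq_ker (surjective_of_coareaFactor_ne_zero hA)
  obtain ⟨N, hN⟩ := exists_norm_sub_starProjection_ker_le A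
  simp_rw [hi] at hN
  obtain ⟨b, hba, hb⟩ : ∃ b : ℝ≥0, b ^ (Module.finrank ℝ E - Module.finrank ℝ F) ≤ a ∧ 1 < b := by
    have pow_lt : ∀ᶠ b : ℝ≥0 in nhds 1, b ^ (Module.finrank ℝ E - Module.finrank ℝ F) < a :=
      (continuous_pow _).continuousAt.eventually_lt continuousAt_const (by simpa)
    have pow_le := (pow_lt.mono fun _ => le_of_lt).filter_mono (nhdsWithin_le_nhds (s := Set.Ioi 1))
    exact (pow_le.and self_mem_nhdsWithin).exists
  have ev_fiber : ∀ᶠ δ : ℝ≥0 in nhds 0, (1 : ℝ) < b * (1 - N * δ) :=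
    continuousAt_const.eventually_lt (by fun_prop) (by simpa)
  obtain ⟨s, hs, near⟩ := Metric.eventually_nhds_iff.1
    (eventually_coareaFactor_comparable (a := a) (by exact_mod_cast ha) hA hi)
  have ev_lt : ∀ᶠ δ : ℝ≥0 in nhds 0, (δ : ℝ) < s :=
    NNReal.continuous_coe.continuousAt.eventually_lt continuousAt_const (by simpa)
  obtain ⟨δ, ⟨hδ, hδs⟩, hpos⟩ := (((ev_fiber.and ev_lt).filter_mono nhdsWithin_le_nhds).and
    (self_mem_nhdsWithin (s := Set.Ioi 0))).exists
  refine ⟨δ, hpos, fun f f' B hB hf' hf =>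
    ⟨_, coareaApprox_of_approximatesLinearOn hB hf' hf hN hδ.le hba fun L hL => near ?_⟩⟩
  rw [dist_eq_norm]
  exact lt_of_le_of_lt (by exact_mod_cast hL) hδs

theorem CoareaApprox.iUnion {B : ℕ → Set E} {a : ℝ≥0} {v : ℕ → F → ℝ≥0∞}
    (h : ∀ k, CoareaApprox f f' (B k) a (v k)) (hB : ∀ k, MeasurableSet (B k))
    (disjoint : Pairwise (Function.onFun Disjoint B)) (hf : ∀ k, ContinuousOn f (B k)) :
    CoareaApprox f f' (⋃ k, B k) a fun z => ∑' k, v k z := by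
  have fiber_eq (z : F) : μHE[Module.finrank ℝ E - Module.finrank ℝ F] ((⋃ k, B k) ∩ f ⁻¹' {z}) =
      ∑' k, μHE[Module.finrank ℝ E - Module.finrank ℝ F] (B k ∩ f ⁻¹' {z}) := by
    rw [Set.iUnion_inter, measure_iUnion
      (fun j k hjk => (disjoint hjk).mono Set.inter_subset_left Set.inter_subset_left)
      (fun k => measurableSet_inter_preimage_singleton (hB k) (hf k) z)]
  have lintegral_tsum_eq : ∫⁻ z, ∑' k, v k z = ∑' k, ∫⁻ z, v k z :=
    lintegral_tsum fun k => (h k).measurable.aemeasurable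
  refine ⟨.tsum fun k => (h k).measurable, fun z => ?_, fun z => ?_, ?_, ?_⟩
  · rw [fiber_eq]
    exact ENNReal.tsum_le_tsum fun k => (h k).le_fiber z
  · rw [fiber_eq, ← ENNReal.tsum_mul_left]
    exact ENNReal.tsum_le_tsum fun k => (h k).fiber_le z
  · rw [lintegral_tsum_eq, lintegral_iUnion hB disjoint, ← ENNReal.tsum_mul_left]
    exact ENNReal.tsum_le_tsum fun k => (h k).lintegral_le
  · rw [lintegral_tsum_eq, lintegral_iUnion hB disjoint, ← ENNReal.tsum_mul_left]
    exact ENNReal.tsum_le_tsum fun k => (h k).le_lintegral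

theorem exists_coareaApprox {a : ℝ≥0} (ha : 1 < a) (hB : MeasurableSet B)
    (hf' : ∀ x ∈ B, HasFDerivWithinAt f (f' x) B x) (hreg : ∀ x ∈ B, coareaFactor (f' x) ≠ 0) :
    ∃ v, CoareaApprox f f' B a v := by
  choose! δ δ_pos hδ using fun (A : E →L[ℝ] F) (hA : coareaFactor A ≠ 0) =>
    exists_coareaApprox_of_approximatesLinearOn ha hA
  rcases B.eq_empty_or_nonempty with rfl | hne
  · exact ⟨0, by constructor <;> simp [measurable_zero]⟩
  classical
  obtain ⟨t, A, disjoint, ht, subset, approx, hA⟩ :=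
    exists_partition_approximatesLinearOn_of_hasFDerivWithinAt f B f' hf'
      (fun A => if coareaFactor A ≠ 0 then δ A else 1)
      fun A => by split_ifs with h; exacts [(δ_pos A h).ne', one_ne_zero]
  have piece_approx (k : ℕ) : ∃ v, CoareaApprox f f' (B ∩ t k) a v := by
    have regular : coareaFactor (A k) ≠ 0 := by
      obtain ⟨y, hy, h⟩ := hA hne k
      exact h ▸ hreg y hy
    refine hδ (A k) regular f f' _ (hB.inter (ht k))
      (fun x hx => (hf' x hx.1).mono Set.inter_subset_left) ?_
    simpa only [if_pos regular] using approx k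
  choose v hv using piece_approx
  refine ⟨fun z => ∑' k, v k z, ?_⟩
  rw [← Set.inter_eq_left.2 subset, Set.inter_iUnion]
  exact .iUnion hv (fun k => hB.inter (ht k))
    (fun j k hjk => (disjoint hjk).mono Set.inter_subset_right Set.inter_subset_right)
    fun k x hx => (hf' x hx.1).continuousWithinAt.mono Set.inter_subset_left

theorem le_of_forall_le_mul_of_tendsto_one {ι : Type*} {l : Filter ι} [l.NeBot] {u : ι → ℝ≥0∞}
    (hu : Filter.Tendsto u l (nhds 1)) {x y : ℝ≥0∞} (h : ∀ k, x ≤ u k * y) : x ≤ y := by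
  have tendsto_mul := ENNReal.Tendsto.mul_const (b := y) hu (Or.inl one_ne_zero)
  rw [one_mul] at tendsto_mul
  exact ge_of_tendsto' tendsto_mul h

theorem exists_seq_one_lt_tendsto_one :
    ∃ u : ℕ → ℝ≥0, (∀ k, 1 < u k) ∧ Filter.Tendsto (fun k => (u k : ℝ≥0∞)) .atTop (nhds 1) := by
  obtain ⟨u, -, one_lt, tendsto⟩ := exists_seq_strictAnti_tendsto (1 : ℝ≥0)
  exact ⟨u, one_lt, ENNReal.tendsto_coe.2 tendsto⟩

theorem measurable_euclideanHausdorffMeasure_fiber (hB : MeasurableSet B)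
    (hf' : ∀ x ∈ B, HasFDerivWithinAt f (f' x) B x) (hreg : ∀ x ∈ B, coareaFactor (f' x) ≠ 0) :
    Measurable fun z => μHE[Module.finrank ℝ E - Module.finrank ℝ F] (B ∩ f ⁻¹' {z}) := by
  obtain ⟨u, one_lt, tendsto⟩ := exists_seq_one_lt_tendsto_one
  choose v hv using fun k => exists_coareaApprox (one_lt k) hB hf' hreg
  have eq_iInf (z : F) : μHE[Module.finrank ℝ E - Module.finrank ℝ F] (B ∩ f ⁻¹' {z}) =
      ⨅ k, u k * v k z := by
    refine le_antisymm (le_iInf fun k => (hv k).fiber_le z) ?_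
    refine le_of_forall_le_mul_of_tendsto_one tendsto fun k => (iInf_le _ k).trans ?_
    gcongr
    exact (hv k).le_fiber z
  simp_rw [eq_iInf]
  exact .iInf fun k => (hv k).measurable.const_mul _

theorem lintegral_euclideanHausdorffMeasure_fiber (hB : MeasurableSet B)
    (hf' : ∀ x ∈ B, HasFDerivWithinAt f (f' x) B x) (hreg : ∀ x ∈ B, coareaFactor (f' x) ≠ 0) :
    ∫⁻ z, μHE[Module.finrank ℝ E - Module.finrank ℝ F] (B ∩ f ⁻¹' {z}) =
      ∫⁻ x in B, ENNReal.ofReal (coareaFactor (f' x)) := by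
  obtain ⟨u, one_lt, tendsto⟩ := exists_seq_one_lt_tendsto_one
  choose v hv using fun k => exists_coareaApprox (one_lt k) hB hf' hreg
  refine le_antisymm ?_ ?_
  · have tendsto_sq : Filter.Tendsto (fun k => (u k : ℝ≥0∞) * u k) .atTop (nhds 1) := by
      simpa only [one_mul] using
        ENNReal.Tendsto.mul tendsto (Or.inl one_ne_zero) tendsto (Or.inl one_ne_zero)
    refine le_of_forall_le_mul_of_tendsto_one tendsto_sq fun k => ?_
    grw [lintegral_mono (hv k).fiber_le, lintegral_const_mul _ (hv k).measurable,
      (hv k).lintegral_le, mul_assoc]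
  · refine le_of_forall_le_mul_of_tendsto_one tendsto fun k => (hv k).le_lintegral.trans ?_
    gcongr
    exact (hv k).le_fiber _

theorem ae_euclideanHausdorffMeasure_fiber_eq_zero (hB : MeasurableSet B)
    (hf' : ∀ x ∈ B, HasFDerivWithinAt f (f' x) B x) (hreg : ∀ x ∈ B, coareaFactor (f' x) ≠ 0)
    {N : Set E} (hNB : N ⊆ B) (hN : volume N = 0) :
    ∀ᵐ z, μHE[Module.finrank ℝ E - Module.finrank ℝ F] (N ∩ f ⁻¹' {z}) = 0 := by
  set M := toMeasurable volume N ∩ B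
  have measurable_M : MeasurableSet M := (measurableSet_toMeasurable volume N).inter hB
  have hf'M : ∀ x ∈ M, HasFDerivWithinAt f (f' x) M x := fun x hx =>
    (hf' x hx.2).mono Set.inter_subset_right
  have hregM : ∀ x ∈ M, coareaFactor (f' x) ≠ 0 := fun x hx => hreg x hx.2
  have volume_M : volume M = 0 :=
    measure_mono_null Set.inter_subset_left ((measure_toMeasurable N).trans hN)
  have lintegral_eq_zero := lintegral_euclideanHausdorffMeasure_fiber measurable_M hf'M hregM
  rw [Measure.restrict_eq_zero.2 volume_M, lintegral_zero_measure,
    lintegral_eq_zero_iff (measurable_euclideanHausdorffMeasure_fiber measurable_M hf'M hregM)]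
    at lintegral_eq_zero
  filter_upwards [lintegral_eq_zero] with z hz
  exact measure_mono_null
    (Set.inter_subset_inter_left _ (Set.subset_inter (subset_toMeasurable _ _) hNB)) hz

end Coarea

section FiberMeasure

variable {E F : Type*} [NormedAddCommGroup E] [InnerProductSpace ℝ E] [FiniteDimensional ℝ E]
  [MeasurableSpace E] [BorelSpace E] [NormedAddCommGroup F] [InnerProductSpace ℝ F]
  [FiniteDimensional ℝ F] [MeasurableSpace F] [BorelSpace F] {f : E → F} {X B : Set E}

theorem map_val_comap_volume {α : Type*} [MeasureSpace α] {s : Set α} (hs : NullMeasurableSet s) :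
    ((volume : Measure α).comap (Subtype.val : s → α)).map Subtype.val = volume.restrict s := by
  ext t ht
  rw [Measure.map_apply measurable_subtype_coe ht, Measure.restrict_apply ht]
  exact volume_preimage_coe hs ht

/-- The Hausdorff measure of codimension `dim F` on the part in `B` of the fiber `f⁻¹(z)`, as a
measure on the set `X`. -/
def fiberMeasure (f : E → F) (X B : Set E) (z : F) : Measure X :=
  μHE[Module.finrank ℝ E - Module.finrank ℝ F].restrict (Subtype.val ⁻¹' (B ∩ f ⁻¹' {z}))

omit [FiniteDimensional ℝ E] [FiniteDimensional ℝ F] [MeasurableSpace F] [BorelSpace F] in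
theorem fiberMeasure_preimage_val {C : Set E} (hC : MeasurableSet C) (z : F) :
    fiberMeasure f X B z (Subtype.val ⁻¹' C) =
      μHE[Module.finrank ℝ E - Module.finrank ℝ F] (C ∩ (X ∩ B) ∩ f ⁻¹' {z}) := by
  rw [fiberMeasure, Measure.restrict_apply (measurable_subtype_coe hC),
    ← isometry_subtype_coe.euclideanHausdorffMeasure_image, ← Set.preimage_inter,
    Subtype.image_preimage_coe]
  congr 1
  grind

theorem measurable_fiberMeasure (hB : MeasurableSet B) (hBX : B ⊆ X)
    (hf : ∀ x ∈ B, DifferentiableAt ℝ f x) (hreg : ∀ x ∈ B, coareaFactor (fderiv ℝ f x) ≠ 0) :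
    Measurable (fiberMeasure f X B) := by
  refine Measure.measurable_of_measurable_coe _ ?_
  rintro _ ⟨C, hC, rfl⟩
  simp only [fiberMeasure_preimage_val hC, Set.inter_eq_right.2 hBX]
  exact measurable_euclideanHausdorffMeasure_fiber (hC.inter hB)
    (fun x hx => (hf x hx.2).hasFDerivAt.hasFDerivWithinAt) fun x hx => hreg x hx.2

theorem bind_fiberMeasure_of_subset (hX : NullMeasurableSet X) (hB : MeasurableSet B) (hBX : B ⊆ X)
    (hf : ∀ x ∈ B, DifferentiableAt ℝ f x) (hreg : ∀ x ∈ B, coareaFactor (fderiv ℝ f x) ≠ 0) :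
    volume.bind (fiberMeasure f X B) = ((volume.comap Subtype.val).restrict
      (Subtype.val ⁻¹' B)).withDensity fun x => .ofReal (coareaFactor (fderiv ℝ f x)) := by
  ext _ ⟨C, hC, rfl⟩
  have measurable_density : Measurable fun x => ENNReal.ofReal (coareaFactor (fderiv ℝ f x)) :=
    (continuous_coareaFactor.measurable.comp (measurable_fderiv ℝ f)).ennreal_ofReal
  rw [Measure.bind_apply (measurable_subtype_coe hC)
      (measurable_fiberMeasure hB hBX hf hreg).aemeasurable,
    withDensity_apply _ (measurable_subtype_coe hC),
    Measure.restrict_restrict (measurable_subtype_coe hC), ← Set.preimage_inter,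
    ← setLIntegral_map (hC.inter hB) measurable_density measurable_subtype_coe,
    map_val_comap_volume hX, Measure.restrict_restrict (hC.inter hB), Set.inter_assoc,
    Set.inter_eq_left.2 hBX, ← lintegral_euclideanHausdorffMeasure_fiber (hC.inter hB)
      (fun x hx => (hf x hx.2).hasFDerivAt.hasFDerivWithinAt) fun x hx => hreg x hx.2]
  simp only [fiberMeasure_preimage_val hC, Set.inter_eq_right.2 hBX]

theorem fiberMeasure_ae_eq {X₀ : Set E} (h_ae : X₀ =ᵐ[volume] X)
    (hB : MeasurableSet B) (hf : ∀ x ∈ B, DifferentiableAt ℝ f x)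
    (hreg : ∀ x ∈ B, coareaFactor (fderiv ℝ f x) ≠ 0) :
    fiberMeasure f X B =ᵐ[volume] fiberMeasure f X (X₀ ∩ B) := by
  have null : volume ((X \ X₀) ∩ B) = 0 :=
    measure_mono_null Set.inter_subset_left (ae_le_set.1 h_ae.symm.le)
  filter_upwards [ae_euclideanHausdorffMeasure_fiber_eq_zero hB
    (fun x hx => (hf x hx).hasFDerivAt.hasFDerivWithinAt) hreg Set.inter_subset_right null]
    with z hz
  refine Measure.restrict_congr_set (Filter.EventuallyLE.antisymm ?_ ?_)
  · rw [ae_le_set, ← isometry_subtype_coe.euclideanHausdorffMeasure_image]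
    refine measure_mono_null ?_ hz
    rintro _ ⟨x, ⟨hx, hx₀⟩, rfl⟩
    exact ⟨⟨⟨x.2, fun h => hx₀ ⟨⟨h, hx.1⟩, hx.2⟩⟩, hx.1⟩, hx.2⟩
  · exact Filter.Eventually.of_forall fun x hx => ⟨hx.1.2, hx.2⟩

theorem aemeasurable_fiberMeasure (hX : NullMeasurableSet X) (hB : MeasurableSet B)
    (hf : ∀ x ∈ B, DifferentiableAt ℝ f x) (hreg : ∀ x ∈ B, coareaFactor (fderiv ℝ f x) ≠ 0) :
    AEMeasurable (fiberMeasure f X B) := by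
  obtain ⟨X₀, hX₀, measurable_X₀, h_ae⟩ := hX.exists_measurable_subset_ae_eq
  exact ⟨_, measurable_fiberMeasure (measurable_X₀.inter hB)
    (Set.inter_subset_left.trans hX₀) (fun x hx => hf x hx.2) fun x hx => hreg x hx.2,
    fiberMeasure_ae_eq h_ae hB hf hreg⟩

theorem bind_fiberMeasure (hX : NullMeasurableSet X) (hB : MeasurableSet B)
    (hf : ∀ x ∈ B, DifferentiableAt ℝ f x) (hreg : ∀ x ∈ B, coareaFactor (fderiv ℝ f x) ≠ 0) :
    volume.bind (fiberMeasure f X B) = ((volume.comap Subtype.val).restrict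
      (Subtype.val ⁻¹' B)).withDensity fun x => .ofReal (coareaFactor (fderiv ℝ f x)) := by
  obtain ⟨X₀, hX₀, measurable_X₀, h_ae⟩ := hX.exists_measurable_subset_ae_eq
  have val_mem_X₀ : ∀ᵐ x : X ∂volume.comap Subtype.val, x.1 ∈ X₀ := by
    refine (ae_map_iff measurable_subtype_coe.aemeasurable measurable_X₀).1 ?_
    rw [map_val_comap_volume hX, ← Measure.restrict_congr_set h_ae]
    exact ae_restrict_mem measurable_X₀
  rw [Measure.bind_congr_right (fiberMeasure_ae_eq h_ae hB hf hreg),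
    bind_fiberMeasure_of_subset hX (measurable_X₀.inter hB) (Set.inter_subset_left.trans hX₀)
      (fun x hx => hf x hx.2) fun x hx => hreg x hx.2]
  congr 1
  refine Measure.restrict_congr_set ?_
  filter_upwards [val_mem_X₀] with x hx
  exact propext (and_iff_right hx)

end FiberMeasure

section WithDensity

variable {α β : Type*} [MeasurableSpace α] [MeasurableSpace β] {ρ : Measure β} {m : β → Measure α}
  {g : α → ℝ≥0∞}

theorem aemeasurable_withDensity (hm : AEMeasurable m ρ) (hg : Measurable g) :
    AEMeasurable (fun z => (m z).withDensity g) ρ := by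
  have measurable_withDensity : Measurable fun ν : Measure α => ν.withDensity g := by
    refine Measure.measurable_of_measurable_coe _ fun s hs => ?_
    simp only [withDensity_apply _ hs, ← lintegral_indicator hs]
    exact Measure.measurable_lintegral (hg.indicator hs)
  exact measurable_withDensity.comp_aemeasurable hm

theorem bind_withDensity (hm : AEMeasurable m ρ) (hg : Measurable g) :
    ρ.bind (fun z => (m z).withDensity g) = (ρ.bind m).withDensity g := by
  ext s hs
  rw [Measure.bind_apply hs (aemeasurable_withDensity hm hg), withDensity_apply _ hs,
    ← lintegral_indicator hs, Measure.lintegral_bind hm (hg.indicator hs).aemeasurable]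
  simp only [withDensity_apply _ hs, lintegral_indicator hs]

end WithDensity

section Disintegration

variable {α β : Type*} [MeasurableSpace α] [MeasurableSpace β]

/-- A disintegration of the measure `μ` along the map `ξ`: `μ = ∫ m z dρ(z)`, where `m z` lives on
the fiber `ξ⁻¹(z)`. The `m z` need not be probability measures. -/
structure IsDisintegration (μ : Measure α) (ξ : α → β) (ρ : Measure β) (m : β → Measure α) :
    Prop where
  measurable : Measurable ξ
  aemeasurable : AEMeasurable m ρ
  bind_eq : ρ.bind m = μ
  ae_fiber : ∀ᵐ z ∂ρ, ∀ᵐ y ∂m z, ξ y = z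

variable {μ : Measure α} {ξ : α → β} {ρ : Measure β} {m : β → Measure α}

namespace IsDisintegration

theorem restrict (h : IsDisintegration μ ξ ρ m) {Z : Set β} (hZ : ∀ z ∉ Z, m z = 0) :
    IsDisintegration μ ξ (ρ.restrict Z) m where
  measurable := h.measurable
  aemeasurable := h.aemeasurable.restrict
  bind_eq := by
    ext s hs
    rw [← h.bind_eq, Measure.bind_apply hs h.aemeasurable.restrict,
      Measure.bind_apply hs h.aemeasurable]
    refine setLIntegral_eq_of_support_subset fun z hz => ?_
    by_contra notMem
    simp [hZ z notMem] at hz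
  ae_fiber := ae_restrict_of_ae h.ae_fiber

theorem lintegral_lintegral (h : IsDisintegration μ ξ ρ m) {g : α → ℝ≥0∞} (hg : Measurable g) :
    ∫⁻ z, ∫⁻ y, g y ∂m z ∂ρ = ∫⁻ y, g y ∂μ := by
  rw [← h.bind_eq, Measure.lintegral_bind h.aemeasurable hg.aemeasurable]

theorem ae_ae_of_ae (h : IsDisintegration μ ξ ρ m) {P : α → Prop} (hP : ∀ᵐ y ∂μ, P y) :
    ∀ᵐ z ∂ρ, ∀ᵐ y ∂m z, P y := by
  rw [← h.bind_eq] at hP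
  exact Measure.ae_ae_of_ae_bind h.aemeasurable hP

theorem ae_comp_of_ae (h : IsDisintegration μ ξ ρ m) {P : β → Prop} (hP : ∀ᵐ z ∂ρ, P z) :
    ∀ᵐ y ∂μ, P (ξ y) := by
  set N := toMeasurable ρ {z | ¬P z}
  have measurable_preimage : MeasurableSet (ξ ⁻¹' N) :=
    h.measurable (measurableSet_toMeasurable _ _)
  have ae_notMem : ∀ᵐ z ∂ρ, z ∉ N :=
    measure_eq_zero_iff_ae_notMem.1 ((measure_toMeasurable _).trans hP)
  have measure_preimage : μ (ξ ⁻¹' N) = 0 := by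
    rw [← h.bind_eq, Measure.bind_apply measurable_preimage h.aemeasurable]
    refine (lintegral_congr_ae ?_).trans lintegral_zero
    filter_upwards [ae_notMem, h.ae_fiber] with z hz fiber
    refine measure_eq_zero_iff_ae_notMem.2 (fiber.mono fun y hy => ?_)
    rwa [Set.mem_preimage, hy]
  exact measure_mono_null (fun y hy => subset_toMeasurable ρ {z | ¬P z} hy) measure_preimage

theorem lintegral_measure_univ (h : IsDisintegration μ ξ ρ m) :
    ∫⁻ z, m z Set.univ ∂ρ = μ Set.univ := by
  rw [← h.bind_eq, Measure.bind_apply .univ h.aemeasurable]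

end IsDisintegration

variable {A G : Type*} [MeasurableSpace A] {ν : Measure A} [NormedAddCommGroup G]

/-- The oscillation of `u a ·` on the fibers carrying the measures `m z`, integrated over `a` and
`z`: one of the two points of a fiber is integrated, the other one averaged. -/
def fiberOscillation (ν : Measure A) (ρ : Measure β) (m : β → Measure α) (u : A → α → G) : ℝ≥0∞ :=
  ∫⁻ z, ∫⁻ y₂, ⨍⁻ y₁, eLpNorm (fun a => u a y₁ - u a y₂) 1 ν ∂m z ∂m z ∂ρ

theorem laverage_const_le (η : Measure α) (c : ℝ≥0∞) : ⨍⁻ _, c ∂η ≤ c := by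
  rw [laverage_eq, lintegral_const]
  exact ENNReal.mul_div_le.trans' (by rw [mul_comm, mul_div_assoc])

theorem lintegral_laverage_add_le (η : Measure α) (e : α → ℝ≥0∞) :
    ∫⁻ y₂, ⨍⁻ y₁, (e y₁ + e y₂) ∂η ∂η ≤ 2 * ∫⁻ y, e y ∂η := by
  have laverage_add_le (y₂ : α) : ⨍⁻ y₁, (e y₁ + e y₂) ∂η ≤ ⨍⁻ y₁, e y₁ ∂η + e y₂ := by
    rw [laverage, lintegral_add_right _ measurable_const]
    exact add_le_add_right (laverage_const_le η _) _
  calc ∫⁻ y₂, ⨍⁻ y₁, (e y₁ + e y₂) ∂η ∂η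
      ≤ ∫⁻ y₂, (⨍⁻ y₁, e y₁ ∂η + e y₂) ∂η := lintegral_mono laverage_add_le
    _ = (⨍⁻ y₁, e y₁ ∂η) * η Set.univ + ∫⁻ y, e y ∂η := by
      rw [lintegral_add_left measurable_const, lintegral_const]
    _ ≤ 2 * ∫⁻ y, e y ∂η := by
      rw [two_mul, laverage_eq]
      gcongr
      exact mul_comm (η Set.univ) _ ▸ ENNReal.mul_div_le

theorem enorm_sub_average_le [NormedSpace ℝ G] [CompleteSpace G] {η : Measure α} [IsFiniteMeasure η]
    [NeZero η] {f : α → G} (hf : AEStronglyMeasurable f η) (c : G) :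
    ‖c - ⨍ y, f y ∂η‖ₑ ≤ ⨍⁻ y, ‖c - f y‖ₑ ∂η := by
  set P := (η Set.univ)⁻¹ • η
  have hfP : AEStronglyMeasurable f P := hf.smul_measure _
  rcases eq_or_ne (⨍⁻ y, ‖c - f y‖ₑ ∂η) ∞ with top | ne_top
  · exact top ▸ le_top
  have integrable_sub : Integrable (fun y => c - f y) P :=
    ⟨aestronglyMeasurable_const.sub hfP, ne_top.lt_top⟩
  have integrable_f : Integrable f P :=
    ((integrable_const c).sub integrable_sub).congr (.of_forall fun y => sub_sub_cancel c (f y))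
  have sub_average : c - ⨍ y, f y ∂η = ⨍ y, (c - f y) ∂η := by
    change c - ∫ y, f y ∂P = ∫ y, (c - f y) ∂P
    rw [integral_sub (integrable_const c) integrable_f, integral_const, probReal_univ, one_smul]
  rw [sub_average]
  exact enorm_integral_le_lintegral_enorm _

theorem fiberOscillation_mono {u v : A → α → G}
    (h : ∀ y₁ y₂, eLpNorm (fun a => u a y₁ - u a y₂) 1 ν ≤ eLpNorm (fun a => v a y₁ - v a y₂) 1 ν) :
    fiberOscillation ν ρ m u ≤ fiberOscillation ν ρ m v :=
  lintegral_mono fun _ => lintegral_mono fun _ => lintegral_mono fun _ => h _ _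

namespace IsDisintegration

theorem fiberOscillation_le_mul (h : IsDisintegration μ ξ ρ m) {u : A → α → G} {C : ℝ≥0∞}
    (hC : ∀ y₁ y₂, eLpNorm (fun a => u a y₁ - u a y₂) 1 ν ≤ C) :
    fiberOscillation ν ρ m u ≤ C * μ Set.univ := by
  calc fiberOscillation ν ρ m u ≤ ∫⁻ z, ∫⁻ _, C ∂m z ∂ρ :=
        lintegral_mono fun z => lintegral_mono fun y₂ =>
          (lintegral_mono fun y₁ => hC y₁ y₂).trans (laverage_const_le (m z) C)
    _ = C * μ Set.univ := by
      rw [h.lintegral_lintegral measurable_const, lintegral_const]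

theorem fiberOscillation_le [SFinite μ] [SFinite ν] (h : IsDisintegration μ ξ ρ m) {u : A → α → G}
    {v : A → β → G}
    (hv : AEStronglyMeasurable (fun q : A × α => u q.1 q.2 - v q.1 (ξ q.2)) (ν.prod μ)) :
    fiberOscillation ν ρ m u ≤
      2 * eLpNorm (fun q : A × α => u q.1 q.2 - v q.1 (ξ q.2)) 1 (ν.prod μ) := by
  set error : α → ℝ≥0∞ := fun y => eLpNorm (fun a => u a y - v a (ξ y)) 1 ν with error_def
  have ae_measurable : ∀ᵐ z ∂ρ, ∀ᵐ y ∂m z,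
      AEStronglyMeasurable (fun a => u a y - v a (ξ y)) ν :=
    h.ae_ae_of_ae hv.prod_swap.prodMk_left
  have error_bound : ∀ᵐ z ∂ρ, ∀ᵐ y₂ ∂m z, ∀ᵐ y₁ ∂m z,
      eLpNorm (fun a => u a y₁ - u a y₂) 1 ν ≤ error y₁ + error y₂ := by
    filter_upwards [ae_measurable, h.ae_fiber] with z measurable fiber
    filter_upwards [measurable, fiber] with y₂ measurable₂ hy₂
    filter_upwards [measurable, fiber] with y₁ measurable₁ hy₁
    convert eLpNorm_sub_le measurable₁ measurable₂ le_rfl using 3 with a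
    rw [Pi.sub_apply, hy₁, hy₂, sub_sub_sub_cancel_right]
  have aemeasurable_error : AEMeasurable error μ := by
    simp only [error_def, eLpNorm_one_eq_lintegral_enorm]
    exact hv.enorm.lintegral_prod_left'
  calc fiberOscillation ν ρ m u
      ≤ ∫⁻ z, ∫⁻ y₂, ⨍⁻ y₁, (error y₁ + error y₂) ∂m z ∂m z ∂ρ :=
        lintegral_mono_ae <| error_bound.mono fun z hz => lintegral_mono_ae <| hz.mono
          fun y₂ hy₂ => lintegral_mono_ae (Measure.smul_absolutelyContinuous.ae_le hy₂)
    _ ≤ ∫⁻ z, 2 * ∫⁻ y, error y ∂m z ∂ρ :=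
        lintegral_mono fun z => lintegral_laverage_add_le (m z) error
    _ = 2 * ∫⁻ y, error y ∂μ := by
        rw [lintegral_const_mul' _ _ ENNReal.ofNat_ne_top, ← h.bind_eq,
          Measure.lintegral_bind h.aemeasurable (h.bind_eq ▸ aemeasurable_error)]
    _ = _ := by
        simp only [error_def, eLpNorm_one_eq_lintegral_enorm]
        rw [lintegral_prod_symm _ hv.enorm]

variable [NormedSpace ℝ G] {u : A → α → G}

theorem aestronglyMeasurable_average_comp [SFinite ν] (h : IsDisintegration μ ξ ρ m)
    (hu : StronglyMeasurable (Function.uncurry u)) :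
    AEStronglyMeasurable (fun q : A × α => ⨍ y, u q.1 y ∂m (ξ q.2)) (ν.prod μ) := by
  set m' := h.aemeasurable.mk m
  have measurable_m' : Measurable m' := h.aemeasurable.measurable_mk
  set κ : Kernel β α := ⟨fun z => (m' z Set.univ)⁻¹ • m' z,
    Measure.measurable_of_measurable_coe _ fun s hs =>
      ((Measure.measurable_coe .univ).comp measurable_m').inv.mul
        ((Measure.measurable_coe hs).comp measurable_m')⟩
  have : IsFiniteKernel κ := ⟨1, ENNReal.one_lt_top, fun z => ENNReal.inv_mul_le_one _⟩
  have stronglyMeasurable_integral :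
      StronglyMeasurable fun w : A × β => ∫ y, u w.1 y ∂κ.prodMkLeft A w :=
    (hu.comp_measurable ((measurable_fst.comp measurable_fst).prodMk
      measurable_snd)).integral_kernel_prod_right'
  refine ⟨_, stronglyMeasurable_integral.comp_measurable
    (measurable_fst.prodMk (h.measurable.comp measurable_snd)), ?_⟩
  filter_upwards [Measure.quasiMeasurePreserving_snd.ae
    (h.ae_comp_of_ae h.aemeasurable.ae_eq_mk)] with q hq
  rw [hq]
  rfl

theorem eLpNorm_sub_average_le [CompleteSpace G] [IsFiniteMeasure μ] [SFinite ν]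
    (h : IsDisintegration μ ξ ρ m) (hu : StronglyMeasurable (Function.uncurry u)) :
    eLpNorm (fun q : A × α => u q.1 q.2 - ⨍ y, u q.1 y ∂m (ξ q.2)) 1 (ν.prod μ) ≤
      fiberOscillation ν ρ m u := by
  have aemeasurable_enorm : AEMeasurable
      (fun q : A × α => ‖u q.1 q.2 - ⨍ y, u q.1 y ∂m (ξ q.2)‖ₑ) (ν.prod μ) :=
    (hu.aestronglyMeasurable.sub (h.aestronglyMeasurable_average_comp hu)).enorm
  have ae_finite : ∀ᵐ z ∂ρ, m z Set.univ < ∞ :=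
    ae_lt_top' ((Measure.measurable_coe .univ).comp_aemeasurable h.aemeasurable)
      (h.lintegral_measure_univ.trans_ne (measure_ne_top μ _))
  have measurable_left (y : α) : StronglyMeasurable fun a => u a y :=
    hu.comp_measurable (measurable_id.prodMk measurable_const)
  have measurable_right (a : A) : StronglyMeasurable (u a) :=
    hu.comp_measurable (measurable_const.prodMk measurable_id)
  rw [eLpNorm_one_eq_lintegral_enorm, lintegral_prod_symm _ aemeasurable_enorm]
  have aemeasurable_error := aemeasurable_enorm.lintegral_prod_left'
  rw [← h.bind_eq] at aemeasurable_error
  nth_rw 1 [← h.bind_eq]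
  rw [Measure.lintegral_bind h.aemeasurable aemeasurable_error]
  refine lintegral_mono_ae ?_
  filter_upwards [h.ae_fiber, ae_finite] with z fiber finite
  have : IsFiniteMeasure (m z) := ⟨finite⟩
  rcases eq_zero_or_neZero (m z) with zero | _
  · simp [zero]
  refine lintegral_mono_ae (fiber.mono fun y₂ hy₂ => ?_)
  calc ∫⁻ a, ‖u a y₂ - ⨍ y, u a y ∂m (ξ y₂)‖ₑ ∂ν
      ≤ ∫⁻ a, ⨍⁻ y₁, ‖u a y₂ - u a y₁‖ₑ ∂m z ∂ν := by
        rw [hy₂]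
        exact lintegral_mono fun a =>
          enorm_sub_average_le (measurable_right a).aestronglyMeasurable _
    _ = ⨍⁻ y₁, ∫⁻ a, ‖u a y₂ - u a y₁‖ₑ ∂ν ∂m z :=
        lintegral_lintegral_swap (((measurable_left y₂).comp_measurable
          measurable_fst).sub hu).enorm.aemeasurable
    _ = ⨍⁻ y₁, eLpNorm (fun a => u a y₁ - u a y₂) 1 ν ∂m z := by
        simp only [eLpNorm_one_eq_lintegral_enorm, enorm_sub_rev]

end IsDisintegration

end Disintegration

section Marginal

variable {n r : ℕ} {X : Set (EuclideanSpace ℝ (Fin n))}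
  {ξ : EuclideanSpace ℝ (Fin n) → EuclideanSpace ℝ (Fin r)}

theorem gramMatrix_eq_gram_adjoint (x : EuclideanSpace ℝ (Fin n)) :
    gramMatrix ξ x = Matrix.gram ℝ fun j =>
      ContinuousLinearMap.adjoint (fderiv ℝ ξ x) (EuclideanSpace.single j 1) := by
  ext i j
  rw [Matrix.gram_apply, ← (EuclideanSpace.basisFun (Fin n) ℝ).sum_inner_mul_inner]
  simp only [gramMatrix, Matrix.mul_apply, Matrix.transpose_apply, Matrix.of_apply]
  refine Finset.sum_congr rfl fun k _ => ?_
  rw [EuclideanSpace.basisFun_apply, ContinuousLinearMap.adjoint_inner_left,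
    ContinuousLinearMap.adjoint_inner_right]
  simp [EuclideanSpace.inner_single_left, EuclideanSpace.inner_single_right]

theorem det_gramMatrix (x : EuclideanSpace ℝ (Fin n)) :
    (gramMatrix ξ x).det = coareaFactor (fderiv ℝ ξ x) ^ 2 := by
  have normDet_sq := LinearMap.normDet_sq_eq_det_gram
    (LinearMap.adjoint (fderiv ℝ ξ x).toLinearMap) (EuclideanSpace.basisFun (Fin r) ℝ)
  simp only [RCLike.ofReal_real_eq_id, id_eq, EuclideanSpace.basisFun_apply] at normDet_sq
  rw [coareaFactor_eq_normDet, gramMatrix_eq_gram_adjoint]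
  exact normDet_sq.symm

theorem det_gramMatrix_rpow (x : EuclideanSpace ℝ (Fin n)) :
    (gramMatrix ξ x).det ^ (-(1 / 2) : ℝ) = (coareaFactor (fderiv ℝ ξ x))⁻¹ := by
  rw [det_gramMatrix, Real.rpow_neg (sq_nonneg _), ← Real.sqrt_eq_rpow,
    Real.sqrt_sq (coareaFactor_nonneg _)]

/-- The points at which `ξ` is differentiable with surjective derivative. -/
def regularSet (ξ : EuclideanSpace ℝ (Fin n) → EuclideanSpace ℝ (Fin r)) :
    Set (EuclideanSpace ℝ (Fin n)) :=
  {x | DifferentiableAt ℝ ξ x ∧ coareaFactor (fderiv ℝ ξ x) ≠ 0}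

theorem measurable_coareaFactor_fderiv : Measurable fun x => coareaFactor (fderiv ℝ ξ x) :=
  continuous_coareaFactor.measurable.comp (measurable_fderiv ℝ ξ)

theorem measurableSet_regularSet : MeasurableSet (regularSet ξ) :=
  (measurableSet_of_differentiableAt ℝ ξ).inter
    (measurable_coareaFactor_fderiv (measurableSet_singleton 0).compl)

theorem measurable_of_differentiableAt (hξ : ∀ x ∈ X, DifferentiableAt ℝ ξ x) :
    Measurable fun x : X => ξ x :=
  (continuousOn_iff_continuous_domRestrict.1 fun x hx =>
    (hξ x hx).continuousAt.continuousWithinAt).measurable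

namespace MarkovSystem

variable {S : MarkovSystem X}

theorem measurable_marginalDensity :
    Measurable fun x : X => ENNReal.ofReal (S.π x * (coareaFactor (fderiv ℝ ξ x))⁻¹) :=
  (S.continuous_π.measurable.mul
    (measurable_coareaFactor_fderiv.comp measurable_subtype_coe).inv).ennreal_ofReal

theorem marginal_eq_withDensity_fiberMeasure (hξ : ∀ x ∈ X, DifferentiableAt ℝ ξ x)
    (z : EuclideanSpace ℝ (Fin r)) :
    S.marginal ξ z = (fiberMeasure ξ X (regularSet ξ) z).withDensity fun x =>
      .ofReal (S.π x * (coareaFactor (fderiv ℝ ξ x))⁻¹) := by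
  have measurable_regular : MeasurableSet (Subtype.val ⁻¹' regularSet ξ : Set X) :=
    measurable_subtype_coe measurableSet_regularSet
  have density_eq_indicator :
      (fun x : X => ENNReal.ofReal (S.π x * (coareaFactor (fderiv ℝ ξ x))⁻¹)) =
        (Subtype.val ⁻¹' regularSet ξ).indicator
          fun x => ENNReal.ofReal (S.π x * (coareaFactor (fderiv ℝ ξ x))⁻¹) := by
    refine (Set.indicator_eq_self.2 fun x hx => ?_).symm
    refine ⟨hξ x x.2, fun factor_eq_zero => hx ?_⟩
    simp only [factor_eq_zero, inv_zero, mul_zero, ENNReal.ofReal_zero]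
  rw [fiberMeasure, Set.preimage_inter, ← Measure.restrict_restrict measurable_regular,
    ← withDensity_indicator measurable_regular, ← density_eq_indicator]
  simp only [marginal, det_gramMatrix_rpow, finrank_euclideanSpace_fin]
  rfl

theorem marginal_eq_zero {Z : Set (EuclideanSpace ℝ (Fin r))} (hξZ : Set.MapsTo ξ X Z)
    {z : EuclideanSpace ℝ (Fin r)} (hz : z ∉ Z) : S.marginal ξ z = 0 := by
  have levelSet_eq_empty : levelSet X ξ z = ∅ :=
    Set.eq_empty_of_forall_notMem fun x (hx : ξ x = z) => hz (hx ▸ hξZ x.2)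
  rw [marginal, levelSet_eq_empty, Measure.restrict_empty, withDensity_zero_left]

theorem lebesgueOn_ae_mem_regularSet (hξ : ∀ x ∈ X, DifferentiableAt ℝ ξ x)
    (hreg : ∀ᵐ x : X ∂lebesgueOn X, (gramMatrix ξ x).det ≠ 0) :
    ∀ᵐ x : X ∂lebesgueOn X, x.1 ∈ regularSet ξ := by
  filter_upwards [hreg] with x hx
  refine ⟨hξ x x.2, fun factor_eq_zero => hx ?_⟩
  rw [det_gramMatrix, factor_eq_zero, zero_pow two_ne_zero]

variable (S) in
theorem aemeasurable_marginal (hX : NullMeasurableSet X) (hξ : ∀ x ∈ X, DifferentiableAt ℝ ξ x) :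
    AEMeasurable (S.marginal ξ) := by
  simp only [funext (marginal_eq_withDensity_fiberMeasure hξ)]
  exact aemeasurable_withDensity (aemeasurable_fiberMeasure hX measurableSet_regularSet
    (fun x hx => hx.1) fun x hx => hx.2) measurable_marginalDensity

variable (S) in
theorem bind_marginal (hX : NullMeasurableSet X) (hξ : ∀ x ∈ X, DifferentiableAt ℝ ξ x)
    (hreg : ∀ᵐ x : X ∂lebesgueOn X, (gramMatrix ξ x).det ≠ 0) :
    volume.bind (S.marginal ξ) = S.μ := by
  have mem_regularSet := lebesgueOn_ae_mem_regularSet hξ hreg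
  have restrict_eq : (lebesgueOn X).restrict (Subtype.val ⁻¹' regularSet ξ) = lebesgueOn X :=
    Measure.restrict_eq_self_of_ae_mem mem_regularSet
  have measurable_factor : Measurable fun x : X => ENNReal.ofReal (coareaFactor (fderiv ℝ ξ x)) :=
    (measurable_coareaFactor_fderiv.comp measurable_subtype_coe).ennreal_ofReal
  rw [funext (marginal_eq_withDensity_fiberMeasure hξ), bind_withDensity
    (aemeasurable_fiberMeasure hX measurableSet_regularSet (fun x hx => hx.1) fun x hx => hx.2)
    measurable_marginalDensity, bind_fiberMeasure hX measurableSet_regularSet (fun x hx => hx.1)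
    fun x hx => hx.2, ← lebesgueOn, restrict_eq,
    ← withDensity_mul _ measurable_factor measurable_marginalDensity, μ, densityMeasure]
  refine withDensity_congr_ae ?_
  filter_upwards [mem_regularSet] with x hx
  rw [Pi.mul_apply, ← ENNReal.ofReal_mul (coareaFactor_nonneg _)]
  congr 1
  have factor_ne_zero := hx.2
  field_simp

variable (S) in
theorem isDisintegration_marginal (hX : NullMeasurableSet X)
    (hξ : ∀ x ∈ X, DifferentiableAt ℝ ξ x)
    (hreg : ∀ᵐ x : X ∂lebesgueOn X, (gramMatrix ξ x).det ≠ 0) :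
    IsDisintegration S.μ (fun x : X => ξ x) volume (S.marginal ξ) where
  measurable := measurable_of_differentiableAt hξ
  aemeasurable := S.aemeasurable_marginal hX hξ
  bind_eq := S.bind_marginal hX hξ hreg
  ae_fiber := .of_forall fun z => (withDensity_absolutelyContinuous _ _).ae_le
    (ae_restrict_mem (measurable_of_differentiableAt hξ (measurableSet_singleton z)))

end MarkovSystem

end Marginal

section TotalVariation

variable {α β : Type*} [MeasurableSpace α] [MeasurableSpace β]

/-- The total variation distance of two finite measures, as the sum of the masses of the positive
and negative parts of their difference; it equals `2` for mutually singular probability measures. -/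
def tvDist (μ ν : Measure α) : ℝ≥0∞ :=
  (μ - ν) Set.univ + (ν - μ) Set.univ

theorem tvDist_le_add (μ ν : Measure α) : tvDist μ ν ≤ μ Set.univ + ν Set.univ :=
  add_le_add (Measure.sub_le _) (Measure.sub_le _)

theorem comp_sub_univ_le (κ : Kernel α β) [IsMarkovKernel κ] (μ ν : Measure α) [IsFiniteMeasure μ]
    [IsFiniteMeasure ν] : (κ ∘ₘ μ - κ ∘ₘ ν) Set.univ ≤ (μ - ν) Set.univ := by
  have le_comp_sub_add : κ ∘ₘ μ ≤ κ ∘ₘ (μ - ν) + κ ∘ₘ ν := by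
    rw [← Measure.comp_add]
    refine Measure.le_intro fun s hs _ => ?_
    rw [Measure.bind_apply hs κ.aemeasurable, Measure.bind_apply hs κ.aemeasurable]
    exact lintegral_mono' (Measure.sub_le_iff_le_add.1 le_rfl) le_rfl
  calc (κ ∘ₘ μ - κ ∘ₘ ν) Set.univ ≤ (κ ∘ₘ (μ - ν)) Set.univ :=
        Measure.sub_le_of_le_add le_comp_sub_add _
    _ = (μ - ν) Set.univ := Measure.comp_apply_univ

theorem tvDist_comp_le (κ : Kernel α β) [IsMarkovKernel κ] (μ ν : Measure α) [IsFiniteMeasure μ]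
    [IsFiniteMeasure ν] : tvDist (κ ∘ₘ μ) (κ ∘ₘ ν) ≤ tvDist μ ν :=
  add_le_add (comp_sub_univ_le κ μ ν) (comp_sub_univ_le κ ν μ)

theorem enorm_sub_eq_ofReal_tsub_add {a b : ℝ} (ha : 0 ≤ a) (hb : 0 ≤ b) :
    ‖a - b‖ₑ = (.ofReal a - .ofReal b) + (.ofReal b - .ofReal a) := by
  rw [← ENNReal.ofReal_sub _ hb, ← ENNReal.ofReal_sub _ ha, Real.enorm_eq_ofReal_abs]
  rcases le_total a b with h | h
  · rw [abs_of_nonpos (sub_nonpos.2 h), ENNReal.ofReal_of_nonpos (sub_nonpos.2 h), zero_add,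
      neg_sub]
  · rw [abs_of_nonneg (sub_nonneg.2 h), ENNReal.ofReal_of_nonpos (sub_nonpos.2 h), add_zero]

theorem eLpNorm_sub_eq_tvDist {μ : Measure α} {f g : α → ℝ} (hf : Measurable f) (hg : Measurable g)
    (f_nonneg : 0 ≤ f) (g_nonneg : 0 ≤ g)
    [IsFiniteMeasure (μ.withDensity fun x => ENNReal.ofReal (f x))]
    [IsFiniteMeasure (μ.withDensity fun x => ENNReal.ofReal (g x))] :
    eLpNorm (fun x => f x - g x) 1 μ =
      tvDist (μ.withDensity fun x => ENNReal.ofReal (f x))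
        (μ.withDensity fun x => ENNReal.ofReal (g x)) := by
  rw [tvDist, ← Measure.withDensity_sub hf.ennreal_ofReal hg.ennreal_ofReal,
    ← Measure.withDensity_sub hg.ennreal_ofReal hf.ennreal_ofReal, withDensity_apply _ .univ,
    withDensity_apply _ .univ, Measure.restrict_univ,
    ← lintegral_add_left (hf.ennreal_ofReal.sub hg.ennreal_ofReal), eLpNorm_one_eq_lintegral_enorm]
  exact lintegral_congr fun x => enorm_sub_eq_ofReal_tsub_add (f_nonneg x) (g_nonneg x)

end TotalVariation

namespace MarkovSystem

section Reversible

variable {n : ℕ} {X : Set (EuclideanSpace ℝ (Fin n))} {S : MarkovSystem X} {s t : ℝ}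

instance : IsProbabilityMeasure S.μ := S.isProbabilityMeasure_π

theorem withDensity_inv_π (S : MarkovSystem X) :
    S.μ.withDensity (fun x => (ENNReal.ofReal (S.π x))⁻¹) = lebesgueOn X :=
  withDensity_inv_same S.continuous_π.measurable.ennreal_ofReal
    (.of_forall fun x => (ENNReal.ofReal_pos.2 (S.π_pos x)).ne')
    (.of_forall fun _ => ENNReal.ofReal_ne_top)

theorem sFinite_lebesgueOn (S : MarkovSystem X) : SFinite (lebesgueOn X) :=
  S.withDensity_inv_π ▸ inferInstance

theorem lebesgueOn_absolutelyContinuous (S : MarkovSystem X) : lebesgueOn X ≪ S.μ :=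
  S.withDensity_inv_π ▸ withDensity_absolutelyContinuous _ _

theorem measurable_p_div_π (ht : 0 < t) :
    Measurable (Function.uncurry fun x y : X => S.p t x y / S.π y) :=
  (S.measurable_p t ht).div (S.continuous_π.measurable.comp measurable_snd)

theorem p_div_π_nonneg (ht : 0 < t) (x y : X) : 0 ≤ S.p t x y / S.π y :=
  div_nonneg (S.p_nonneg t ht x y) (S.π_pos y).le

theorem p_div_π_symm (ht : 0 < t) (x y : X) : S.p t x y / S.π y = S.p t y x / S.π x := by
  rw [div_eq_div_iff (S.π_pos y).ne' (S.π_pos x).ne', S.detailed_balance t ht]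

theorem withDensity_p_div_π (ht : 0 < t) (y : X) :
    S.μ.withDensity (fun x => ENNReal.ofReal (S.p t x y / S.π y)) = S.P t y := by
  have measurable_π : Measurable fun x => ENNReal.ofReal (S.π x) :=
    S.continuous_π.measurable.ennreal_ofReal
  have measurable_density : Measurable fun x => ENNReal.ofReal (S.p t x y / S.π y) :=
    (measurable_p_div_π ht).of_uncurry_right.ennreal_ofReal
  rw [μ, densityMeasure, ← withDensity_mul _ measurable_π measurable_density, S.P_eq_density t ht,
    densityMeasure]
  congr 1
  ext x
  rw [Pi.mul_apply, p_div_π_symm ht, ← ENNReal.ofReal_mul (S.π_pos x).le,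
    mul_div_cancel₀ _ (S.π_pos x).ne']

theorem observableDist_eq_tvDist (ht : 0 < t) (y₁ y₂ : X) :
    S.observableDist t y₁ y₂ = tvDist (S.P t y₁) (S.P t y₂) := by
  have := S.isMarkovKernel_P t ht
  have finite (y : X) :
      IsFiniteMeasure (S.μ.withDensity fun x => ENNReal.ofReal (S.p t x y / S.π y)) :=
    withDensity_p_div_π ht y ▸ inferInstance
  rw [observableDist, eLpNorm_sub_eq_tvDist (measurable_p_div_π ht).of_uncurry_right
    (measurable_p_div_π ht).of_uncurry_right (fun x => p_div_π_nonneg ht x y₁)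
    fun x => p_div_π_nonneg ht x y₂, withDensity_p_div_π ht, withDensity_p_div_π ht]

theorem observableDist_le_two (ht : 0 < t) (y₁ y₂ : X) : S.observableDist t y₁ y₂ ≤ 2 := by
  have := S.isMarkovKernel_P t ht
  rw [observableDist_eq_tvDist ht]
  exact (tvDist_le_add _ _).trans_eq (by rw [measure_univ, measure_univ, one_add_one_eq_two])

theorem observableDist_antitoneOn (y₁ y₂ : X) :
    AntitoneOn (fun t => S.observableDist t y₁ y₂) (Set.Ioi 0) := by
  rintro s (hs : 0 < s) t (ht : 0 < t) hst
  rcases hst.eq_or_lt with rfl | lt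
  · rfl
  have markov_s := S.isMarkovKernel_P s hs
  have markov_sub := S.isMarkovKernel_P (t - s) (sub_pos.2 lt)
  have P_eq (y : X) : S.P t y = S.P (t - s) ∘ₘ S.P s y := by
    rw [← Kernel.comp_apply, ← S.chapman_kolmogorov s (t - s) hs (sub_pos.2 lt),
      add_sub_cancel]
  beta_reduce
  rw [observableDist_eq_tvDist ht, observableDist_eq_tvDist hs, P_eq, P_eq]
  exact tvDist_comp_le _ _ _

end Reversible

section Deflatable

variable {n r : ℕ} {X : Set (EuclideanSpace ℝ (Fin n))} {S : MarkovSystem X} {τ : ℝ}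
  {ξ : EuclideanSpace ℝ (Fin n) → EuclideanSpace ℝ (Fin r)} {Z : Set (EuclideanSpace ℝ (Fin r))}
  {pD : ℝ → X → EuclideanSpace ℝ (Fin r) → ℝ} {ε : ℝ≥0}

section Prod

variable {A : Type*} [MeasurableSpace A] {ν : Measure A}

theorem prod_μ :
    ν.prod S.μ =
      (ν.prod (lebesgueOn X)).withDensity fun q => ENNReal.ofReal (S.π q.2) := by
  have := S.sFinite_lebesgueOn
  exact prod_withDensity_right S.continuous_π.measurable.ennreal_ofReal

theorem measurable_π_snd :
    Measurable fun q : A × X => ENNReal.ofReal (S.π q.2) :=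
  (S.continuous_π.measurable.comp measurable_snd).ennreal_ofReal

theorem memLp_mul_π_iff {g : A × X → ℝ} :
    MemLp (fun q => g q * S.π q.2) 1 (ν.prod (lebesgueOn X)) ↔ MemLp g 1 (ν.prod S.μ) := by
  rw [memLp_one_iff_integrable, memLp_one_iff_integrable, prod_μ,
    integrable_withDensity_iff_integrable_smul' measurable_π_snd
      (.of_forall fun _ => ENNReal.ofReal_lt_top)]
  simp only [ENNReal.toReal_ofReal (S.π_pos _).le, smul_eq_mul, mul_comm]

theorem eLpNorm_mul_π (g : A × X → ℝ) :
    eLpNorm (fun q => g q * S.π q.2) 1 (ν.prod (lebesgueOn X)) = eLpNorm g 1 (ν.prod S.μ) := by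
  rw [eLpNorm_one_eq_lintegral_enorm, eLpNorm_one_eq_lintegral_enorm, prod_μ,
    lintegral_withDensity_eq_lintegral_mul_non_measurable _ measurable_π_snd
      (.of_forall fun _ => ENNReal.ofReal_lt_top)]
  refine lintegral_congr fun q => ?_
  rw [enorm_mul, Real.enorm_of_nonneg (S.π_pos q.2).le, Pi.mul_apply, mul_comm]

end Prod

theorem isDeflatableWith_iff :
    S.IsDeflatableWith τ ξ Z pD ε ↔ ∀ t, τ ≤ t → (∀ x, ∀ z ∈ Z, 0 ≤ pD t x z) ∧
      MemLp (fun q : X × X => S.p t q.1 q.2 / S.π q.2 - pD t q.1 (ξ q.2)) 1 (S.μ.prod S.μ) ∧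
      (volume Z)⁻¹ * eLpNorm (fun q : X × X => S.p t q.1 q.2 / S.π q.2 - pD t q.1 (ξ q.2)) 1
        (S.μ.prod S.μ) ≤ ε := by
  have factor (t : ℝ) (q : X × X) : S.p t q.1 q.2 - pD t q.1 (ξ q.2) * S.π q.2 =
      (S.p t q.1 q.2 / S.π q.2 - pD t q.1 (ξ q.2)) * S.π q.2 := by
    rw [sub_mul, div_mul_cancel₀ _ (S.π_pos q.2).ne']
  simp only [IsDeflatableWith, factor, memLp_mul_π_iff, eLpNorm_mul_π]

theorem isAvgDiffDeflatable_iff : S.IsAvgDiffDeflatable τ ξ Z ε ↔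
    (volume Z)⁻¹ * fiberOscillation S.μ (volume.restrict Z) (S.marginal ξ)
      (fun x y => S.p τ x y / S.π y) ≤ ε :=
  Iff.rfl

theorem isDiffDeflatable_iff
    (hprob : ∀ᵐ z ∂volume.restrict Z, IsProbabilityMeasure (S.marginal ξ z)) :
    S.IsDiffDeflatable τ ξ Z ε ↔ S.IsAvgDiffDeflatable τ ξ Z ε := by
  have lintegral_eq_laverage : ∀ᵐ z ∂volume.restrict Z,
      ∫⁻ y₂, ∫⁻ y₁, S.observableDist τ y₁ y₂ ∂S.marginal ξ z ∂S.marginal ξ z =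
        ∫⁻ y₂, ⨍⁻ y₁, S.observableDist τ y₁ y₂ ∂S.marginal ξ z ∂S.marginal ξ z := by
    filter_upwards [hprob] with z _
    simp only [laverage_eq_lintegral]
  rw [IsDiffDeflatable, IsAvgDiffDeflatable, lintegral_congr_ae lintegral_eq_laverage]

variable (h : IsDisintegration S.μ (fun x : X => ξ x) (volume.restrict Z) (S.marginal ξ))
include h

theorem IsDeflatable.isAvgDiffDeflatable (hd : S.IsDeflatable τ ξ Z ε) :
    S.IsAvgDiffDeflatable τ ξ Z (2 * ε) := by
  obtain ⟨pD, hpD⟩ := hd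
  obtain ⟨-, memLp, norm_le⟩ := isDeflatableWith_iff.1 hpD τ le_rfl
  rw [isAvgDiffDeflatable_iff]
  calc (volume Z)⁻¹ * fiberOscillation S.μ (volume.restrict Z) (S.marginal ξ)
        (fun x y => S.p τ x y / S.π y)
      ≤ (volume Z)⁻¹ * (2 * eLpNorm
        (fun q : X × X => S.p τ q.1 q.2 / S.π q.2 - pD τ q.1 (ξ q.2)) 1 (S.μ.prod S.μ)) := by
        gcongr
        exact h.fiberOscillation_le (v := pD τ) memLp.1
    _ ≤ 2 * ε := by
        rw [mul_left_comm]
        gcongr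
    _ = ((2 * ε : ℝ≥0) : ℝ≥0∞) := by push_cast; rfl

theorem IsAvgDiffDeflatable.isDeflatableWith_average (hτ : 0 < τ)
    (hd : S.IsAvgDiffDeflatable τ ξ Z ε) :
    S.IsDeflatableWith τ ξ Z (fun t x z => ⨍ y, S.p t x y / S.π y ∂S.marginal ξ z) ε := by
  refine isDeflatableWith_iff.2 fun t hτt => ?_
  have ht : 0 < t := hτ.trans_le hτt
  set u : X → X → ℝ := fun x y => S.p t x y / S.π y
  have measurable_u : StronglyMeasurable (Function.uncurry u) :=
    (measurable_p_div_π ht).stronglyMeasurable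
  have norm_le_oscillation := h.eLpNorm_sub_average_le (ν := S.μ) measurable_u
  have oscillation_le_two :
      fiberOscillation S.μ (volume.restrict Z) (S.marginal ξ) u ≤ 2 * S.μ Set.univ :=
    h.fiberOscillation_le_mul (observableDist_le_two ht)
  have oscillation_antitone : fiberOscillation S.μ (volume.restrict Z) (S.marginal ξ) u ≤
      fiberOscillation S.μ (volume.restrict Z) (S.marginal ξ) fun x y => S.p τ x y / S.π y :=
    fiberOscillation_mono fun y₁ y₂ => observableDist_antitoneOn y₁ y₂ hτ ht hτt
  refine ⟨fun x z _ => integral_nonneg (p_div_π_nonneg ht x), ⟨?_, ?_⟩, ?_⟩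
  · exact measurable_u.aestronglyMeasurable.sub (h.aestronglyMeasurable_average_comp measurable_u)
  · exact (norm_le_oscillation.trans oscillation_le_two).trans_lt (by simp)
  · grw [norm_le_oscillation, oscillation_antitone]
    exact isAvgDiffDeflatable_iff.1 hd

theorem IsDeflatableWith.congr_ae {pD' : ℝ → X → EuclideanSpace ℝ (Fin r) → ℝ}
    (hd : S.IsDeflatableWith τ ξ Z pD ε)
    (nonneg : ∀ t, τ ≤ t → ∀ x, ∀ z ∈ Z, 0 ≤ pD' t x z)
    (congr : ∀ᵐ z ∂volume.restrict Z, ∀ t x, pD t x z = pD' t x z) :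
    S.IsDeflatableWith τ ξ Z pD' ε := by
  intro t hτt
  obtain ⟨-, memLp, norm_le⟩ := hd t hτt
  have := S.sFinite_lebesgueOn
  have error_congr : (fun q : X × X => S.p t q.1 q.2 - pD t q.1 (ξ q.2) * S.π q.2)
      =ᵐ[S.μ.prod (lebesgueOn X)]
        fun q : X × X => S.p t q.1 q.2 - pD' t q.1 (ξ q.2) * S.π q.2 := by
    filter_upwards [Measure.quasiMeasurePreserving_snd.ae
      (S.lebesgueOn_absolutelyContinuous.ae_le (h.ae_comp_of_ae congr))] with q hq
    rw [hq]
  exact ⟨nonneg t hτt, (memLp_congr_ae error_congr).1 memLp, eLpNorm_congr_ae error_congr ▸ norm_le⟩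

theorem IsDiffDeflatable.isDeflatableWith_integral (hτ : 0 < τ)
    (hprob : ∀ᵐ z ∂volume.restrict Z, IsProbabilityMeasure (S.marginal ξ z))
    (hd : S.IsDiffDeflatable τ ξ Z ε) :
    S.IsDeflatableWith τ ξ Z (fun t x z => ∫ y, S.p t x y / S.π y ∂S.marginal ξ z) ε := by
  have deflatable_average := ((isDiffDeflatable_iff hprob).1 hd).isDeflatableWith_average h hτ
  refine deflatable_average.congr_ae h
    (fun t hτt x z _ => integral_nonneg (p_div_π_nonneg (hτ.trans_le hτt) x)) ?_
  filter_upwards [hprob] with z _ t x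
  rw [average_eq_integral]

end Deflatable

end MarkovSystem

end ReactionCoordinate

end

theorem mainTheorem7_general {n r : ℕ}
    (X : Set (EuclideanSpace ℝ (Fin n))) (hX : NullMeasurableSet X volume)
    (S : ReactionCoordinate.MarkovSystem X) (τ : ℝ) (hτ : 0 < τ)
    (Z : Set (EuclideanSpace ℝ (Fin r)))
    (ξ : EuclideanSpace ℝ (Fin n) → EuclideanSpace ℝ (Fin r))
    (hξ : ∀ x ∈ X, DifferentiableAt ℝ ξ x) (hξZ : Set.MapsTo ξ X Z)
    (hreg : ∀ᵐ x : X ∂(ReactionCoordinate.lebesgueOn X),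
      (ReactionCoordinate.gramMatrix ξ x).det ≠ 0)
    (ε : ℝ≥0) :
    ((∀ᵐ z ∂(volume.restrict Z), IsProbabilityMeasure (S.marginal ξ z)) →
      (S.IsDeflatable τ ξ Z ε → S.IsDiffDeflatable τ ξ Z (2 * ε)) ∧
      (S.IsDiffDeflatable τ ξ Z ε →
        S.IsDeflatable τ ξ Z ε ∧
        S.IsDeflatableWith τ ξ Z (fun t x z => ∫ y, S.p t x y / S.π y ∂(S.marginal ξ z)) ε)) ∧
    (S.IsDeflatable τ ξ Z ε → S.IsAvgDiffDeflatable τ ξ Z (2 * ε)) ∧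
    (S.IsAvgDiffDeflatable τ ξ Z ε →
      S.IsDeflatable τ ξ Z ε ∧
      S.IsDeflatableWith τ ξ Z (fun t x z => ⨍ y, S.p t x y / S.π y ∂(S.marginal ξ z)) ε) := by
  have disintegration :
      ReactionCoordinate.IsDisintegration S.μ (fun x : X => ξ x) (volume.restrict Z)
        (S.marginal ξ) :=
    (S.isDisintegration_marginal hX hξ hreg).restrict fun _ hz =>
      ReactionCoordinate.MarkovSystem.marginal_eq_zero hξZ hz
  refine ⟨fun hprob => ⟨fun deflatable => ?_, fun diffDeflatable => ?_⟩,
    fun deflatable => deflatable.isAvgDiffDeflatable disintegration, fun diffDeflatable => ?_⟩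
  · exact (ReactionCoordinate.MarkovSystem.isDiffDeflatable_iff hprob).2
      (deflatable.isAvgDiffDeflatable disintegration)
  · have deflatableWith := diffDeflatable.isDeflatableWith_integral disintegration hτ hprob
    exact ⟨⟨_, deflatableWith⟩, deflatableWith⟩
  · have deflatableWith := diffDeflatable.isDeflatableWith_average disintegration hτ
    exact ⟨⟨_, deflatableWith⟩, deflatableWith⟩

theorem mainTheorem7 {n r : ℕ} (hrn : r ≤ n)
    (X : Set (EuclideanSpace ℝ (Fin n))) (hX : NullMeasurableSet X volume)
    (S : ReactionCoordinate.MarkovSystem X) (τ : ℝ) (hτ : 0 < τ)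
    (Z : Set (EuclideanSpace ℝ (Fin r))) (hZ : MeasurableSet Z)
    -- the reaction coordinate: `C¹` near `X`, with values in `Z` on `X`
    (ξ : EuclideanSpace ℝ (Fin n) → EuclideanSpace ℝ (Fin r))
    (U : Set (EuclideanSpace ℝ (Fin n))) (hU : IsOpen U) (hXU : X ⊆ U)
    (hξ : ContDiffOn ℝ 1 ξ U) (hξZ : Set.MapsTo ξ X Z)
    -- almost every point of `X` is a regular point of `ξ`
    (hreg : ∀ᵐ x : X ∂(ReactionCoordinate.lebesgueOn X), (ReactionCoordinate.gramMatrix ξ x).det ≠ 0)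
    (ε : ℝ≥0) :
    -- the statement for marginal measures `μ_z` that are probability measures
    ((∀ᵐ z ∂(volume.restrict Z), IsProbabilityMeasure (S.marginal ξ z)) →
      (S.IsDeflatable τ ξ Z ε → S.IsDiffDeflatable τ ξ Z (2 * ε)) ∧
      (S.IsDiffDeflatable τ ξ Z ε →
        S.IsDeflatable τ ξ Z ε ∧
        S.IsDeflatableWith τ ξ Z (fun t x z => ∫ y, S.p t x y / S.π y ∂(S.marginal ξ z)) ε)) ∧
    -- the statement without normalization of the marginal measures
    (S.IsDeflatable τ ξ Z ε → S.IsAvgDiffDeflatable τ ξ Z (2 * ε)) ∧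
    (S.IsAvgDiffDeflatable τ ξ Z ε →
      S.IsDeflatable τ ξ Z ε ∧
      S.IsDeflatableWith τ ξ Z (fun t x z => ⨍ y, S.p t x y / S.π y ∂(S.marginal ξ z)) ε) := by
  exact mainTheorem7_general X hX S τ hτ Z ξ
    (fun x hx => (hξ.contDiffAt (hU.mem_nhds (hXU hx))).differentiableAt one_ne_zero) hξZ hreg ε
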